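/- Let $k$ be a field, $n\ge 0$ an integer, and let $\Lambda_n$ be the path algebra over $k$ of the quiver $1\leftarrow 2\leftarrow\cdots\leftarrow n$; let $\operatorname{mod}\Lambda_n$ be the category of left $\Lambda_n$-modules of finite length. For $1\le a<b\le n+1$ let $[a,b]$ be the interval module: the representation with the vector space $k$ at the vertices $x$ with $a\le x\le b-1$, zero at the other vertices, and identity maps along the arrows between vertices of this support. A partition $P$ of $\{1,\dots,n+1\}$ is non-crossing if, whenever $i<i'<j<j'$ with $i,j$ in the same part and $i',j'$ in the same part, all four elements lie in the same part. An arc of $P$ is a pair $[a,b]$ with $a<b$ in the same part of $P$ such that no $c$ with $a<c<b$ belongs to this part. Let $A(P)$ be the set of (isomorphism classes of) modules $[a,b]$ with $[a,b]$ an arc of $P$. Let $NC(n+1)$ be the set of non-crossing partitions of $\{1,\dots,n+1\}$, ordered by $P\le P'$ iff every part of $P$ is contained in a part of $P'$. An antichain in $\operatorname{mod}\Lambda_n$ is a set of isomorphism classes of pairwise orthogonal bricks (a brick is a module whose endomorphism ring is a division ring; orthogonal means that $\operatorname{Hom}(X,Y)=0$ for non-isomorphic members $X,Y$). It is exceptional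 if its $\operatorname{Ext}$-quiver (with an arrow $X\to Y$ iff $\operatorname{Ext}^1(X,Y)\ne 0$) has no oriented cyclic path. Let $\mathbf A(\operatorname{mod}\Lambda_n)$ be the set of exceptional antichains, with $S\le T$ iff $\mathcal E(S)\subseteq\mathcal E(T)$, where $\mathcal E(S)$ is the class of all modules having a finite filtration with factors in $S$. Then: 1. For every partition $P$ of $\{1,\dots,n+1\}$: $P$ is non-crossing if and only if $A(P)$ is an antichain in $\operatorname{mod}\Lambda_n$. 2. The map $P\mapsto A(P)$ is an isomorphism of posets $NC(n+1)\to\mathbf A(\operatorname{mod}\Lambda_n)$ (in particular, it is bijective, and $\le$ is a partial order on $\mathbf A(\operatorname{mod}\Lambda_n)$). 3. For $S,T\in\mathbf A(\operatorname{mod}\Lambda_n)$: $S\le T$ if and only if the thick closure of $S$ is contained in the thick closure of $T$. Here the thick closure of $S$ is the smallest full subcategory of $\operatorname{mod}\Lambda_n$ which contains $0$ and $S$ and is closed under kernels, cokernels and extensions. -/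

import Mathlib

open CategoryTheory

universe u v

namespace ArcCat

/-! ### Partitions, arcs, non-crossing partitions

The set `{1, …, m}` of the text is `Fin m` (the number `x` is the element `x - 1` of `Fin m`).
The order on `Finpartition` is the one with `P ≤ P'` iff every part of `P` is contained in a
part of `P'`. -/

/-- Partitions of an `m`-element linearly ordered set. -/
abbrev Partition (m : ℕ) : Type := Finpartition (Finset.univ : Finset (Fin m))

/-- `P` is non-crossing: if `i < i' < j < j'` with `i, j` in a part `B` and `i', j'` in a part
`B'`, then `B = B'`. -/
def IsNonCrossing {m : ℕ} (P : Partition m) : Prop :=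
  ∀ i i' j j' : Fin m, i < i' → i' < j → j < j' →
    ∀ B ∈ P.parts, ∀ B' ∈ P.parts, i ∈ B → j ∈ B → i' ∈ B' → j' ∈ B' → B = B'

/-- The poset `NC(m)`. -/
abbrev NC (m : ℕ) : Type := {P : Partition m // IsNonCrossing P}

/-- `[a, b]` is an arc of `P`: `a < b` belong to the same part, and this part contains no `c`
with `a < c < b`. -/
def IsArc {m : ℕ} (P : Partition m) (a b : Fin m) : Prop :=
  a < b ∧ ∃ B ∈ P.parts, a ∈ B ∧ b ∈ B ∧ ∀ c : Fin m, a < c → c < b → c ∉ B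

/-! ### Path algebras -/

section PathAlgebra

variable (k : Type u) (Q : Type v) [Quiver.{0} Q]

/-- All paths of the quiver `Q`: source, target, path. -/
abbrev AllPaths : Type v := Σ a b : Q, Quiver.Path a b

variable {Q}

/-- The product `p * q` of two paths, "first `q`, then `p`": it is defined iff `q` ends where `p`
starts. With this convention left modules are covariant representations of `Q`. -/
def AllPaths.mul? [DecidableEq Q] (p q : AllPaths Q) : Option (AllPaths Q) :=
  if h : q.2.1 = p.1 then some ⟨q.1, p.2.1, (q.2.2.cast rfl h).comp p.2.2⟩ else none

variable (Q)

/-- The path algebra `k Q`: the vector space with basis the set of all paths of `Q`. -/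
def PathAlgebra [Zero k] : Type (max u v) := AllPaths Q →₀ k

namespace PathAlgebra

variable [Field k]

noncomputable instance : AddCommGroup (PathAlgebra k Q) :=
  inferInstanceAs (AddCommGroup (AllPaths Q →₀ k))

noncomputable instance : Module k (PathAlgebra k Q) :=
  inferInstanceAs (Module k (AllPaths Q →₀ k))

variable {Q}

/-- A path as an element of the path algebra. -/
noncomputable def of (p : AllPaths Q) : PathAlgebra k Q :=
  (Finsupp.single p (1 : k) : AllPaths Q →₀ k)

variable (Q)

/-- The linear extension of a map that is given on paths. -/
noncomputable def lift {V : Type*} [AddCommGroup V] [Module k V] (φ : AllPaths Q → V) :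
    PathAlgebra k Q →ₗ[k] V :=
  (Finsupp.linearCombination k φ : (AllPaths Q →₀ k) →ₗ[k] V)

variable {Q}

@[simp] theorem lift_of {V : Type*} [AddCommGroup V] [Module k V] (φ : AllPaths Q → V)
    (p : AllPaths Q) : lift k Q φ (of k p) = φ p := by
  simp only [lift, of]
  exact (Finsupp.linearCombination_single k (1 : k) p).trans (one_smul k _)

theorem hom_ext {V : Type*} [AddCommGroup V] [Module k V] {f g : PathAlgebra k Q →ₗ[k] V}
    (h : ∀ p, f (of k p) = g (of k p)) : f = g :=
  Finsupp.lhom_ext' (M := k) (R := k) (φ := f) (ψ := g) fun p => LinearMap.ext_ring (h p)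

@[elab_as_elim]
theorem induction_on {C : PathAlgebra k Q → Prop} (x : PathAlgebra k Q) (zero : C 0)
    (add : ∀ x y, C x → C y → C (x + y)) (smul : ∀ (c : k) p, C (c • of k p)) : C x := by
  refine Finsupp.induction_linear (motive := C) x zero add fun p c => ?_
  have h : (Finsupp.single p c : AllPaths Q →₀ k) = c • Finsupp.single p (1 : k) := by
    rw [Finsupp.smul_single, smul_eq_mul, mul_one]
  rw [h]
  exact smul c p

/-- The unit element is the sum of the trivial paths. -/
noncomputable instance [Fintype Q] : One (PathAlgebra k Q) :=
  ⟨∑ a : Q, of k ⟨a, a, Quiver.Path.nil⟩⟩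

theorem one_def [Fintype Q] :
    (1 : PathAlgebra k Q) = ∑ a : Q, of k ⟨a, a, Quiver.Path.nil⟩ := rfl

variable [DecidableEq Q]

/-- The multiplication on basis elements: concatenation of paths, or zero. -/
noncomputable def mulBasis (p q : AllPaths Q) : PathAlgebra k Q :=
  ((p.mul? q).map (of k)).getD 0

variable (Q)

/-- The bilinear multiplication map of the path algebra. -/
noncomputable def mulMap : PathAlgebra k Q →ₗ[k] PathAlgebra k Q →ₗ[k] PathAlgebra k Q :=
  lift k Q fun p => lift k Q fun q => mulBasis k p q

variable {Q}

noncomputable instance : Mul (PathAlgebra k Q) := ⟨fun x y => mulMap k Q x y⟩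

theorem mul_def (x y : PathAlgebra k Q) : x * y = mulMap k Q x y := rfl

theorem of_mul_of (p q : AllPaths Q) :
    of k p * of k q = ((p.mul? q).map (of k)).getD 0 := by
  simp [mul_def, mulMap, mulBasis]

theorem of_mul_of_comp {a b c : Q} (q : Quiver.Path a b) (p : Quiver.Path b c) :
    of k (⟨b, c, p⟩ : AllPaths Q) * of k ⟨a, b, q⟩ = of k ⟨a, c, q.comp p⟩ := by
  simp [of_mul_of, AllPaths.mul?]

theorem of_mul_of_ne {a b b' c : Q} (q : Quiver.Path a b) (p : Quiver.Path b' c) (h : b ≠ b') :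
    of k (⟨b', c, p⟩ : AllPaths Q) * of k ⟨a, b, q⟩ = 0 := by
  simp [of_mul_of, AllPaths.mul?, h]

theorem mul_assoc_basis (p q r : AllPaths Q) :
    of k p * of k q * of k r = of k p * (of k q * of k r) := by
  obtain ⟨c', d, p⟩ := p
  obtain ⟨b', c, q⟩ := q
  obtain ⟨a, b, r⟩ := r
  by_cases h₁ : c = c'
  · subst h₁
    rw [of_mul_of_comp]
    by_cases h₂ : b = b'
    · subst h₂
      rw [of_mul_of_comp, of_mul_of_comp, of_mul_of_comp, Quiver.Path.comp_assoc]
    · rw [of_mul_of_ne k _ _ h₂, of_mul_of_ne k _ _ h₂, mul_def, map_zero]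
  · rw [of_mul_of_ne k _ _ h₁, mul_def _ 0, map_zero, LinearMap.zero_apply]
    by_cases h₂ : b = b'
    · subst h₂
      rw [of_mul_of_comp, of_mul_of_ne k _ _ h₁]
    · rw [of_mul_of_ne k _ _ h₂, mul_def, map_zero]

theorem mul_assoc_aux (x y z : PathAlgebra k Q) : x * y * z = x * (y * z) := by
  simp only [mul_def]
  induction x using induction_on with
  | zero => simp
  | add x x' hx hx' => simp only [map_add, LinearMap.add_apply, hx, hx']
  | smul c p =>
  induction y using induction_on with
  | zero => simp
  | add y y' hy hy' => simp only [map_add, LinearMap.add_apply, hy, hy']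
  | smul c' q =>
  induction z using induction_on with
  | zero => simp
  | add z z' hz hz' => simp only [map_add, hz, hz']
  | smul c'' r =>
    simp only [map_smul, LinearMap.smul_apply]
    have h := mul_assoc_basis k p q r
    simp only [mul_def] at h
    rw [h]

variable [Fintype Q]

theorem one_mul_aux (x : PathAlgebra k Q) : 1 * x = x := by
  suffices h : mulMap k Q 1 = LinearMap.id by rw [mul_def, h, LinearMap.id_apply]
  refine hom_ext k ?_
  rintro ⟨a, b, p⟩
  rw [one_def, map_sum, LinearMap.sum_apply, Finset.sum_eq_single b]
  · exact of_mul_of_comp k p Quiver.Path.nil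
  · exact fun c _ hc => of_mul_of_ne k _ _ hc.symm
  · exact fun h => absurd (Finset.mem_univ b) h

theorem mul_one_aux (x : PathAlgebra k Q) : x * 1 = x := by
  suffices h : (mulMap k Q).flip 1 = LinearMap.id by
    rw [mul_def, ← LinearMap.flip_apply, h, LinearMap.id_apply]
  refine hom_ext k ?_
  rintro ⟨a, b, p⟩
  rw [LinearMap.flip_apply, one_def, map_sum, LinearMap.id_apply, Finset.sum_eq_single a]
  · have h := of_mul_of_comp k (Quiver.Path.nil : Quiver.Path a a) p
    rwa [Quiver.Path.nil_comp] at h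
  · exact fun c _ hc => of_mul_of_ne k (Quiver.Path.nil : Quiver.Path c c) p hc
  · exact fun h => absurd (Finset.mem_univ a) h

noncomputable instance : Ring (PathAlgebra k Q) where
  __ := (inferInstance : AddCommGroup (PathAlgebra k Q))
  mul_assoc := mul_assoc_aux k
  one_mul := one_mul_aux k
  mul_one := mul_one_aux k
  left_distrib x y z := by simp only [mul_def, map_add]
  right_distrib x y z := by simp only [mul_def, map_add, LinearMap.add_apply]
  zero_mul x := by simp only [mul_def, map_zero, LinearMap.zero_apply]
  mul_zero x := by simp only [mul_def, map_zero]

noncomputable instance : Algebra k (PathAlgebra k Q) :=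
  Algebra.ofModule (fun c x y => by simp only [mul_def, map_smul, LinearMap.smul_apply])
    (fun c x y => by simp only [mul_def, map_smul])

/-- An algebra homomorphism out of the path algebra is obtained from a multiplicative map on
paths. -/
noncomputable def liftAlgHom {A : Type*} [Ring A] [Algebra k A] (φ : AllPaths Q → A)
    (h_comp : ∀ (a b c : Q) (q : Quiver.Path a b) (p : Quiver.Path b c),
      φ ⟨a, c, q.comp p⟩ = φ ⟨b, c, p⟩ * φ ⟨a, b, q⟩)
    (h_ne : ∀ (a b b' c : Q) (q : Quiver.Path a b) (p : Quiver.Path b' c), b ≠ b' →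
      φ ⟨b', c, p⟩ * φ ⟨a, b, q⟩ = 0)
    (h_one : ∑ a : Q, φ ⟨a, a, Quiver.Path.nil⟩ = 1) : PathAlgebra k Q →ₐ[k] A :=
  AlgHom.ofLinearMap (lift k Q φ)
    (by rw [one_def, map_sum, ← h_one]; exact Finset.sum_congr rfl fun a _ => lift_of k φ _)
    (by
      intro x y
      induction x using induction_on with
      | zero => simp
      | add x x' hx hx' => simp only [map_add, add_mul, hx, hx']
      | smul c p =>
      induction y using induction_on with
      | zero => simp
      | add y y' hy hy' => simp only [map_add, mul_add, hy, hy']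
      | smul c' q =>
        obtain ⟨b', c₀, p⟩ := p
        obtain ⟨a, b, q⟩ := q
        simp only [smul_mul_assoc, mul_smul_comm, map_smul, lift_of]
        by_cases h : b = b'
        · subst h
          rw [of_mul_of_comp, lift_of, h_comp]
        · rw [of_mul_of_ne k _ _ h, h_ne _ _ _ _ _ _ h, map_zero])

end PathAlgebra

end PathAlgebra

/-! ### The algebra `Λ_n` and its interval modules -/

/-- The vertices of the linearly oriented quiver `1 ← 2 ← ⋯ ← n`; the vertex `x` is the element
`x - 1` of `Fin n`. -/
def LinearQuiver (n : ℕ) : Type := Fin n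

instance (n : ℕ) : Fintype (LinearQuiver n) := inferInstanceAs (Fintype (Fin n))

instance (n : ℕ) : DecidableEq (LinearQuiver n) := inferInstanceAs (DecidableEq (Fin n))

/-- The position of a vertex, counted from `0`. -/
def LinearQuiver.val {n : ℕ} (x : LinearQuiver n) : ℕ := Fin.val x

/-- There is exactly one arrow from `j` to `i` if `j = i + 1`, and no other arrow. -/
instance linearQuiver (n : ℕ) : Quiver.{0} (LinearQuiver n) where
  Hom j i := PLift (j.val = i.val + 1)

theorem le_of_path {n : ℕ} {j i : LinearQuiver n} (p : Quiver.Path j i) : i.val ≤ j.val := by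
  induction p with
  | nil => exact le_rfl
  | cons _ e ih => have := e.down; omega

/-- `Λ_n`, the path algebra of `1 ← 2 ← ⋯ ← n` over the field `k`. -/
abbrev Lam (k : Type u) [Field k] (n : ℕ) : Type u := PathAlgebra k (LinearQuiver n)

/-- The set of vertices `x` with `a ≤ x ≤ b - 1`. -/
abbrev Support {n : ℕ} (a b : Fin (n + 1)) : Type :=
  {x : LinearQuiver n // a.val ≤ x.val ∧ x.val < b.val}

/-- The underlying space of the module `[a, b]`: the representation which has the vector space `k`
at the vertices `x` with `a ≤ x ≤ b - 1`, and `0` at the other vertices. -/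
def Interval (k : Type u) {n : ℕ} (a b : Fin (n + 1)) : Type u := Support a b → k

@[ext]
theorem Interval.ext (k : Type u) {n : ℕ} {a b : Fin (n + 1)} {v w : Interval k a b}
    (h : ∀ y : Support a b, v y = w y) : v = w :=
  funext h

section Interval

variable (k : Type u) [Field k] {n : ℕ} (a b : Fin (n + 1))

noncomputable instance : AddCommGroup (Interval k a b) :=
  inferInstanceAs (AddCommGroup (Support a b → k))

noncomputable instance : Module k (Interval k a b) :=
  inferInstanceAs (Module k (Support a b → k))

instance : Module.Finite k (Interval k a b) :=
  inferInstanceAs (Module.Finite k (Support a b → k))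


/-- A path from `j` to `i` acts on `[a, b]` as the identity from the copy of `k` at the vertex `j`
to the copy of `k` at the vertex `i` if both vertices are in the support, and as zero otherwise. -/
noncomputable def pathMap (p : AllPaths (LinearQuiver n)) :
    (Support a b → k) →ₗ[k] (Support a b → k) where
  toFun v := fun y =>
    if h : y.1 = p.2.1 ∧ a.val ≤ p.1.val ∧ p.1.val < b.val then v ⟨p.1, h.2⟩ else 0
  map_add' v w := by
    funext y
    by_cases h : y.1 = p.2.1 ∧ a.val ≤ p.1.val ∧ p.1.val < b.val
    · simp only [dif_pos h, Pi.add_apply]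
    · simp only [dif_neg h, Pi.add_apply, add_zero]
  map_smul' c v := by
    funext y
    by_cases h : y.1 = p.2.1 ∧ a.val ≤ p.1.val ∧ p.1.val < b.val
    · simp only [dif_pos h, Pi.smul_apply, RingHom.id_apply]
    · simp only [dif_neg h, Pi.smul_apply, smul_zero]

/-- The action of a path, as an endomorphism of the vector space `[a, b]`. -/
noncomputable def pathAction (p : AllPaths (LinearQuiver n)) : Module.End k (Interval k a b) :=
  pathMap k a b p

theorem pathAction_apply (p : AllPaths (LinearQuiver n)) (v : Interval k a b) (y : Support a b) :
    pathAction k a b p v y =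
      if h : y.1 = p.2.1 ∧ a.val ≤ p.1.val ∧ p.1.val < b.val then v ⟨p.1, h.2⟩ else 0 := rfl

/-- The structure map of the representation `[a, b]`. -/
noncomputable def intervalAction : Lam k n →ₐ[k] Module.End k (Interval k a b) :=
  PathAlgebra.liftAlgHom k (pathAction k a b)
    (by
      intro x y z q p
      have hq := le_of_path q
      have hp := le_of_path p
      refine LinearMap.ext fun v => Interval.ext k fun w => ?_
      rw [Module.End.mul_apply, pathAction_apply, pathAction_apply]
      by_cases h1 : w.1 = z
      · by_cases h2 : a.val ≤ x.val ∧ x.val < b.val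
        · have h3 : a.val ≤ y.val ∧ y.val < b.val := by
            have := w.2
            rw [h1] at this
            omega
          rw [dif_pos ⟨h1, h2⟩, dif_pos ⟨h1, h3⟩, pathAction_apply, dif_pos ⟨rfl, h2⟩]
        · rw [dif_neg (fun h => h2 h.2)]
          split
          · rw [pathAction_apply, dif_neg (fun h => h2 h.2)]
          · rfl
      · rw [dif_neg (fun h => h1 h.1), dif_neg (fun h => h1 h.1)])
    (by
      intro x y y' z q p hne
      refine LinearMap.ext fun v => Interval.ext k fun w => ?_
      rw [Module.End.mul_apply, pathAction_apply]
      split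
      · rw [pathAction_apply, dif_neg (fun h => hne h.1.symm)]
        rfl
      · rfl)
    (by
      refine LinearMap.ext fun v => Interval.ext k fun w => ?_
      rw [LinearMap.sum_apply, Module.End.one_apply]
      refine (Finset.sum_apply (M := fun _ => k) w Finset.univ
        fun x => pathAction k a b ⟨x, x, Quiver.Path.nil⟩ v).trans ?_
      rw [Finset.sum_eq_single w.1]
      · rw [pathAction_apply, dif_pos ⟨rfl, w.2⟩]
      · intro c _ hc
        rw [pathAction_apply, dif_neg (fun h => hc h.1.symm)]
      · exact fun h => absurd (Finset.mem_univ _) h)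

noncomputable instance : Module (Lam k n) (Interval k a b) :=
  Module.compHom (Interval k a b) (intervalAction k a b).toRingHom

theorem lam_smul_def (r : Lam k n) (v : Interval k a b) : r • v = intervalAction k a b r v := rfl

instance : IsScalarTower k (Lam k n) (Interval k a b) where
  smul_assoc c r v := by
    rw [lam_smul_def, lam_smul_def, map_smul, LinearMap.smul_apply]

theorem interval_isFiniteLength : IsFiniteLength (Lam k n) (Interval k a b) := by
  rw [isFiniteLength_iff_isNoetherian_isArtinian]
  exact ⟨isNoetherian_of_tower k inferInstance, isArtinian_of_tower k inferInstance⟩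

end Interval

/-! ### Antichains in `mod R`, extension closures, thick closures -/

section Modules

variable (R : Type u) [Ring R]

/-- The class of modules of finite length. -/
def FiniteLength : ObjectProperty (ModuleCat.{u} R) := fun M => IsFiniteLength R M

/-- `mod R`, the category of left `R`-modules of finite length. -/
abbrev FinMod : Type (u + 1) := (FiniteLength R).FullSubcategory

/-- The isomorphism classes of objects in `mod R`. -/
def IsoClass : Type (u + 1) := Quotient (isIsomorphicSetoid (FinMod R))

variable {R}

/-- The isomorphism class of a module. -/
def cls (X : FinMod R) : IsoClass R := Quotient.mk (isIsomorphicSetoid (FinMod R)) X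

/-- A brick: the endomorphism ring is a division ring. -/
def IsBrick (X : FinMod R) : Prop :=
  Nontrivial (Module.End R X.obj) ∧ ∀ f : Module.End R X.obj, f ≠ 0 → IsUnit f

/-- An antichain in `mod R`: a set of (isomorphism classes of) pairwise orthogonal bricks. -/
structure IsModAntichain (S : Set (IsoClass R)) : Prop where
  isBrick : ∀ X : FinMod R, cls X ∈ S → IsBrick X
  orthogonal : ∀ X Y : FinMod R, cls X ∈ S → cls Y ∈ S → cls X ≠ cls Y →
    ∀ f : X.obj →ₗ[R] Y.obj, f = 0

/-- The arrows of the `Ext`-quiver of a set of isomorphism classes: there is an arrow `x → y` iff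
`Ext¹(x, y) ≠ 0`. -/
def ExtArrow {S : Set (IsoClass R)} (x y : S) : Prop :=
  ∃ X Y : FinMod R, cls X = x.1 ∧ cls Y = y.1 ∧ Nontrivial (Abelian.Ext X.obj Y.obj 1)

/-- An exceptional antichain: the `Ext`-quiver has no oriented cyclic path (of length `≥ 1`). -/
structure IsExceptionalAntichain (S : Set (IsoClass R)) : Prop extends IsModAntichain S where
  acyclic : ∀ x : S, ¬ Relation.TransGen ExtArrow x x

/-- The extension closure of `S`: all modules `M` which have a finite filtration
`0 = F 0 ⊆ F 1 ⊆ ⋯ ⊆ F m = M` by submodules, with all factors `F (i + 1) / F i` in `S`. -/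
def extClosure (S : Set (IsoClass R)) : ObjectProperty (ModuleCat.{u} R) := fun M =>
  ∃ (m : ℕ) (F : ℕ → Submodule R M), Monotone F ∧ F 0 = ⊥ ∧ F m = ⊤ ∧
    ∀ i < m, ∃ X : FinMod R, cls X ∈ S ∧
      Nonempty ((F (i + 1) ⧸ (F i).submoduleOf (F (i + 1))) ≃ₗ[R] X.obj)

/-- A thick subcategory of `mod R`: a full subcategory containing the zero module which is closed
under kernels, cokernels and extensions. -/
structure IsThick (P : ObjectProperty (ModuleCat.{u} R)) : Prop where
  le_finiteLength : P ≤ FiniteLength R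
  containsZero : P.ContainsZero
  kernels : P.IsClosedUnderKernels
  cokernels : P.IsClosedUnderCokernels
  extensions : P.IsClosedUnderExtensions

/-- The thick closure of `S`, i.e. the smallest thick subcategory of `mod R` which contains `S`. -/
def thickClosure (S : Set (IsoClass R)) : ObjectProperty (ModuleCat.{u} R) := fun M =>
  FiniteLength R M ∧ ∀ P : ObjectProperty (ModuleCat.{u} R), IsThick P →
    (∀ X : FinMod R, cls X ∈ S → P X.obj) → P M

variable (R)

/-- The set `A(mod R)` of exceptional antichains in `mod R`. -/
def ExcAntichain : Type (u + 1) := {S : Set (IsoClass R) // IsExceptionalAntichain S}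

/-- The order on the exceptional antichains: `A ≤ B` iff the extension closure of `A` is contained
in the extension closure of `B`. -/
instance : Preorder (ExcAntichain R) := Preorder.lift fun A => extClosure A.1

end Modules

/-! ### The map `A` -/

section Map

variable (k : Type u) [Field k] {n : ℕ}

/-- The module `[a, b]` as an object of `mod Λ_n`. -/
noncomputable def intervalModule (a b : Fin (n + 1)) : FinMod (Lam k n) :=
  ⟨ModuleCat.of (Lam k n) (Interval k a b), interval_isFiniteLength k a b⟩

/-- `A(P)`: the set of the `Λ_n`-modules `[a, b]`, where `[a, b]` is an arc of `P`. -/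
def arcModules (P : Partition (n + 1)) : Set (IsoClass (Lam k n)) :=
  {x | ∃ a b : Fin (n + 1), IsArc P a b ∧ x = cls (intervalModule k a b)}

end Map

end ArcCat

namespace ArcCat

/-! ### Paths of the linear quiver -/

section Paths

variable {n : ℕ}

/-! Everything is read off from endpoints. Counted from 0, `[a, b]` occupies the positions `x` with
`a ≤ x < b`, paths lead downwards, and for `a < b` the module is generated by a vector at `b - 1`. A
homomorphism from `[a, b]` to `[c, d]` is therefore given by one scalar, and a nonzero one exists
exactly when `a ≤ c < b ≤ d` (`le_of_interval_hom_ne_zero`, `intervalHom_ne_zero`). The bricks are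
the nonzero interval modules (`isBrick_interval`, `exists_intervalEquiv_of_brick`).

Two different arcs of a partition share neither their left nor their right endpoint, so between them
the inequality is strict at both ends and describes a crossing. Conversely, orthogonality gives each
point at most one successor and one predecessor among the intervals of an antichain, so these
intervals are the arcs of a partition (`exists_partition_isArc_iff`, `exists_arcModules_eq`).
Exceptionality is automatic: an `Ext`-arrow strictly lowers the left endpoint (`lt_of_extArrow`).

For the order, three implications form a circle. If `P ≤ P'`, every arc of `P` is cut into arcs of
`P'`, and its module is an iterated extension of theirs (`extClosure_arcModules_mono`). Inclusion of
extension closures gives inclusion of thick closures, because thick subcategories are closed under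
extensions. The way back needs an invariant: modules whose structure map from position `d` to
position `c` is bijective form a thick subcategory (`isThick_bijectiveAt`), and `[a, b]` belongs to
it iff it contains both positions or neither. When `a` and `b` lie in different parts of a
non-crossing partition, some pair `(c, d)` is separated by `[a, b)` but by no arc of the partition
(`exists_unseparated`). The position `n`, where every module is zero, must be allowed here. -/

theorem LinearQuiver.val_injective {x y : LinearQuiver n} (h : x.val = y.val) : x = y :=
  Fin.ext h

theorem LinearQuiver.val_lt (x : LinearQuiver n) : x.val < n := Fin.isLt x

/-- The vertex at a given position. -/
def LinearQuiver.mk (d : ℕ) (h : d < n) : LinearQuiver n := (⟨d, h⟩ : Fin n)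

@[simp] theorem LinearQuiver.val_mk (d : ℕ) (h : d < n) : (LinearQuiver.mk d h).val = d := rfl

theorem nonempty_path : ∀ (m : ℕ) (j i : LinearQuiver n), j.val = i.val + m →
    Nonempty (Quiver.Path j i)
  | 0, j, i, h => by
    obtain rfl := LinearQuiver.val_injective (show j.val = i.val by omega)
    exact ⟨Quiver.Path.nil⟩
  | m + 1, j, i, h => by
    have hlt : i.val + 1 < n := by have := j.val_lt; omega
    obtain ⟨p⟩ := nonempty_path m j (LinearQuiver.mk (i.val + 1) hlt)
      (by rw [LinearQuiver.val_mk]; omega)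
    exact ⟨p.cons ⟨rfl⟩⟩

/-- The last arrow of a path ending at `i` must start at `i + 1`, and a nontrivial path never
returns to its start. -/
theorem path_unique {j i : LinearQuiver n} (p q : Quiver.Path j i) : p = q := by
  induction p with
  | nil =>
    cases q with
    | nil => rfl
    | cons q e =>
      have h1 := le_of_path q
      have h2 := e.down
      omega
  | cons p e ih =>
    cases q with
    | nil =>
      have h1 := le_of_path p
      have h2 := e.down
      omega
    | cons q e' =>
      rename_i b c b'
      obtain rfl : b = b' :=
        LinearQuiver.val_injective (by have h1 := e.down; have h2 := e'.down; omega)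
      obtain rfl : e = e' := PLift.down_injective rfl
      rw [ih q]

variable (k : Type u) [Field k]

/-- The path from the vertex `d` to the vertex `c` as an element of the path algebra; it is zero
unless `c ≤ d < n`. -/
noncomputable def pathElt (n c d : ℕ) : Lam k n :=
  if h : c ≤ d ∧ d < n then
    PathAlgebra.of k ⟨LinearQuiver.mk d h.2, LinearQuiver.mk c (h.1.trans_lt h.2),
      (nonempty_path (d - c) (LinearQuiver.mk d h.2) (LinearQuiver.mk c (h.1.trans_lt h.2))
        (by simp only [LinearQuiver.val_mk]; omega)).some⟩
  else 0

/-- Indices beyond the last vertex act as zero, which lets the right endpoint `b = n` of an interval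
be treated like any other position. -/
theorem pathElt_of_le {c d : ℕ} (h : n ≤ d) : pathElt k n c d = 0 :=
  dif_neg fun h' => by omega

theorem of_eq_pathElt (p : AllPaths (LinearQuiver n)) :
    PathAlgebra.of k p = pathElt k n p.2.1.val p.1.val := by
  obtain ⟨j, i, p⟩ := p
  rw [pathElt, dif_pos ⟨le_of_path p, j.val_lt⟩]
  congr
  exact path_unique _ _

theorem pathElt_eq_of {j i : LinearQuiver n} (p : Quiver.Path j i) {c d : ℕ} (hc : i.val = c)
    (hd : j.val = d) : pathElt k n c d = PathAlgebra.of k ⟨j, i, p⟩ := by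
  subst hc hd
  exact (of_eq_pathElt k ⟨j, i, p⟩).symm

theorem exists_pathElt_eq {c d : ℕ} (h : c ≤ d) (hd : d < n) :
    ∃ p : Quiver.Path (LinearQuiver.mk d hd) (LinearQuiver.mk c (h.trans_lt hd)),
      pathElt k n c d = PathAlgebra.of k ⟨_, _, p⟩ := by
  obtain ⟨p⟩ := nonempty_path (d - c) (LinearQuiver.mk d hd) (LinearQuiver.mk c (h.trans_lt hd))
        (by simp only [LinearQuiver.val_mk]; omega)
  exact ⟨p, pathElt_eq_of k p rfl rfl⟩

theorem pathElt_mul {c d e : ℕ} (h : c ≤ d) (h' : d ≤ e) :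
    pathElt k n c d * pathElt k n d e = pathElt k n c e := by
  by_cases he : e < n
  · obtain ⟨p, hp⟩ := exists_pathElt_eq k h (h'.trans_lt he)
    obtain ⟨q, hq⟩ := exists_pathElt_eq k h' he
    rw [hp, hq, PathAlgebra.of_mul_of_comp]
    exact (pathElt_eq_of k _ rfl rfl).symm
  · rw [pathElt_of_le k (not_lt.1 he), pathElt_of_le k (not_lt.1 he), mul_zero]

theorem pathElt_mul_of_ne {c d d' e : ℕ} (h : d ≠ d') :
    pathElt k n c d * pathElt k n d' e = 0 := by
  by_cases h1 : c ≤ d ∧ d < n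
  · by_cases h2 : d' ≤ e ∧ e < n
    · obtain ⟨p, hp⟩ := exists_pathElt_eq k h1.1 h1.2
      obtain ⟨q, hq⟩ := exists_pathElt_eq k h2.1 h2.2
      rw [hp, hq, PathAlgebra.of_mul_of_ne]
      intro h3
      exact h (congrArg LinearQuiver.val h3).symm
    · rw [pathElt, pathElt, dif_neg h2, mul_zero]
  · rw [pathElt, pathElt, dif_neg h1, zero_mul]

theorem one_eq_sum_pathElt : (1 : Lam k n) = ∑ x ∈ Finset.range n, pathElt k n x x := by
  rw [PathAlgebra.one_def, Finset.sum_range]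
  exact Finset.sum_congr rfl fun x _ => of_eq_pathElt k _

/-! ### Action of the path elements on modules -/

section Linear

variable {k}
variable {M N : Type*} [AddCommGroup M] [Module (Lam k n) M]
  [AddCommGroup N] [Module (Lam k n) N]

theorem pathElt_smul_smul {c d e : ℕ} (h : c ≤ d) (h' : d ≤ e) (m : M) :
    pathElt k n c d • pathElt k n d e • m = pathElt k n c e • m := by
  rw [smul_smul, pathElt_mul k h h']

theorem pathElt_smul_smul_of_ne {c d d' e : ℕ} (h : d ≠ d') (m : M) :
    pathElt k n c d • pathElt k n d' e • m = 0 := by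
  rw [smul_smul, pathElt_mul_of_ne k h, zero_smul]

theorem sum_pathElt_smul (m : M) : ∑ x ∈ Finset.range n, pathElt k n x x • m = m := by
  rw [← Finset.sum_smul, ← one_eq_sum_pathElt, one_smul]

/-- A `k`-linear map which commutes with the paths is linear over the path algebra. -/
def linearMapOfPaths [Module k M] [IsScalarTower k (Lam k n) M] [Module k N]
    [IsScalarTower k (Lam k n) N] (f : M →ₗ[k] N)
    (h : ∀ c d, c ≤ d → d < n → ∀ m, f (pathElt k n c d • m) = pathElt k n c d • f m) :
    M →ₗ[Lam k n] N where
  toFun := f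
  map_add' := f.map_add
  map_smul' r m := by
    induction r using PathAlgebra.induction_on with
    | zero => simp
    | add x y hx hy => simp only [RingHom.id_apply] at hx hy ⊢; rw [add_smul, map_add, hx, hy, add_smul]
    | smul c p =>
      rw [RingHom.id_apply, smul_assoc, map_smul, smul_assoc, of_eq_pathElt,
        h _ _ (le_of_path p.2.2) p.1.val_lt]

@[simp] theorem linearMapOfPaths_apply [Module k M] [IsScalarTower k (Lam k n) M] [Module k N]
    [IsScalarTower k (Lam k n) N] (f : M →ₗ[k] N)
    (h : ∀ c d, c ≤ d → d < n → ∀ m, f (pathElt k n c d • m) = pathElt k n c d • f m) (m : M) :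
    linearMapOfPaths f h m = f m := rfl

end Linear

end Paths

/-! ### Coordinates of interval modules and the universal maps -/

section Coord

variable {k : Type u} [Field k] {n : ℕ} {a b : Fin (n + 1)}

/-- The component of a vector of `[a, b]` at the vertex `d`, zero outside of the support. -/
noncomputable def coord (a b : Fin (n + 1)) (d : ℕ) : Interval k a b →ₗ[k] k where
  toFun v := if h : a.val ≤ d ∧ d < b.val then
    v ⟨LinearQuiver.mk d (by have := b.isLt; omega), h⟩ else 0
  map_add' v w := by
    split
    · rfl
    · rw [add_zero]
  map_smul' c v := by
    split
    · rfl
    · rw [smul_zero]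

theorem coord_of_not {d : ℕ} (h : ¬(a.val ≤ d ∧ d < b.val)) (v : Interval k a b) :
    coord a b d v = 0 := dif_neg h

theorem coord_ext {v w : Interval k a b}
    (h : ∀ d, a.val ≤ d → d < b.val → coord a b d v = coord a b d w) : v = w := by
  refine Interval.ext k fun y => ?_
  have := h y.1.val y.2.1 y.2.2
  simp only [coord, LinearMap.coe_mk, AddHom.coe_mk, dif_pos y.2] at this
  exact this

/-- The vector of `[a, b]` with given components. -/
def ofCoord (a b : Fin (n + 1)) (f : ℕ → k) : Interval k a b := fun y => f y.1.val

theorem coord_ofCoord (f : ℕ → k) {d : ℕ} (h : a.val ≤ d) (h' : d < b.val) :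
    coord a b d (ofCoord a b f) = f d := dif_pos ⟨h, h'⟩

theorem coord_pathElt_smul (x c d : ℕ) (v : Interval k a b) :
    coord a b x (pathElt k n c d • v) = if x = c ∧ c ≤ d ∧ a.val ≤ c then coord a b d v else 0 := by
  by_cases hcd : c ≤ d ∧ d < n
  · obtain ⟨p, hp⟩ := exists_pathElt_eq k hcd.1 hcd.2
    rw [hp, lam_smul_def]
    have h1 : intervalAction k a b (PathAlgebra.of k ⟨_, _, p⟩) = pathAction k a b ⟨_, _, p⟩ :=
      PathAlgebra.lift_of k _ _
    rw [h1]
    by_cases hx : a.val ≤ x ∧ x < b.val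
    · simp only [coord, LinearMap.coe_mk, AddHom.coe_mk, dif_pos hx, pathAction_apply]
      have h2 : (LinearQuiver.mk x (by have := b.isLt; omega) =
        LinearQuiver.mk c (hcd.1.trans_lt hcd.2)) ↔ x = c :=
        ⟨fun h => congrArg LinearQuiver.val h, fun h => LinearQuiver.val_injective h⟩
      split_ifs with h3 h4 h5 h5 h6
      · rfl
      · exact absurd h3.2 h5
      · exact absurd ⟨h2.1 h3.1, hcd.1, h2.1 h3.1 ▸ hx.1⟩ h4
      · exact absurd ⟨h2.2 h5.1, h6⟩ h3
      · rfl
      · rfl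
    · rw [coord_of_not hx]
      split
      · rw [coord_of_not]
        omega
      · rfl
  · rw [pathElt, dif_neg hcd, zero_smul, map_zero]
    split
    · rw [coord_of_not]
      have := b.isLt
      omega
    · rfl

theorem interval_subsingleton (h : b ≤ a) : Subsingleton (Interval k a b) :=
  ⟨fun v w => coord_ext fun d h1 h2 => by have := Fin.le_def.1 h; omega⟩

/-! ### Homomorphisms into and out of interval modules -/

section Universal

variable {M : Type*} [AddCommGroup M] [Module (Lam k n) M] [Module k M]
  [IsScalarTower k (Lam k n) M]

theorem pathElt_smul_comm (r : Lam k n) (t : k) (m : M) : r • t • m = t • r • m := by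
  rw [← algebraMap_smul (Lam k n) t m, smul_smul, ← Algebra.commutes, ← smul_smul,
    algebraMap_smul]

/-- The homomorphism to `[a, b]` given by a linear form on the component at the vertex `a` which
vanishes on the image of the component at the vertex `b`. -/
noncomputable def toInterval (φ : M →ₗ[k] k) (hφ : ∀ m, φ (pathElt k n a.val b.val • m) = 0) :
    M →ₗ[Lam k n] Interval k a b :=
  linearMapOfPaths
    { toFun := fun m => ofCoord a b fun x => φ (pathElt k n a.val x • m)
      map_add' := fun m m' => coord_ext fun d h1 h2 => by
        simp only [map_add, coord_ofCoord _ h1 h2, smul_add]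
      map_smul' := fun t m => coord_ext fun d h1 h2 => by
        simp only [RingHom.id_apply, map_smul, coord_ofCoord _ h1 h2, pathElt_smul_comm] }
    (by
      intro c d hcd hd m
      refine coord_ext fun x h1 h2 => ?_
      rw [coord_pathElt_smul]
      simp only [LinearMap.coe_mk, AddHom.coe_mk, coord_ofCoord _ h1 h2]
      by_cases hxc : x = c
      · subst hxc
        rw [if_pos ⟨rfl, hcd, h1⟩, pathElt_smul_smul h1 hcd]
        by_cases hdb : d < b.val
        · rw [coord_ofCoord _ (h1.trans hcd) hdb]
        -- For `d ≥ b` the path from `d` to `a` passes through `b`, where `φ` vanishes by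
        -- hypothesis.
        · rw [coord_of_not (by omega),
            ← pathElt_smul_smul (h1.trans h2.le) (not_lt.1 hdb), hφ]
      · rw [if_neg fun h => hxc h.1, pathElt_smul_smul_of_ne hxc, map_zero])

theorem coord_toInterval (φ : M →ₗ[k] k) (hφ : ∀ m, φ (pathElt k n a.val b.val • m) = 0) (m : M)
    {x : ℕ} (h : a.val ≤ x) (h' : x < b.val) :
    coord a b x (toInterval φ hφ m) = φ (pathElt k n a.val x • m) :=
  coord_ofCoord (fun x => φ (pathElt k n a.val x • m)) h h'

/-- The homomorphism from `[a, b]` given by an element of the component at the vertex `b - 1`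
whose image at the vertex `a - 1` vanishes. -/
noncomputable def fromInterval (v : M)
    (hv : ∀ c, c < a.val → pathElt k n c (b.val - 1) • v = 0) :
    Interval k a b →ₗ[Lam k n] M :=
  linearMapOfPaths
    (∑ x ∈ Finset.Ico a.val b.val,
      (coord a b x).smulRight (pathElt k n x (b.val - 1) • v))
    (by
      intro c d hcd hd w
      simp only [LinearMap.coe_sum, Finset.sum_apply, LinearMap.smulRight_apply, Finset.smul_sum,
        pathElt_smul_comm, coord_pathElt_smul]
      by_cases hdb : a.val ≤ d ∧ d < b.val
      · rw [Finset.sum_eq_single_of_mem (f := fun x => coord a b x w •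
            pathElt k n c d • pathElt k n x (b.val - 1) • v) d (Finset.mem_Ico.2 hdb)
          (fun x _ hx => by rw [pathElt_smul_smul_of_ne hx.symm, smul_zero]),
          pathElt_smul_smul hcd (by omega)]
        by_cases hc : a.val ≤ c
        · rw [Finset.sum_eq_single_of_mem c (Finset.mem_Ico.2 ⟨hc, by omega⟩)
            (fun x _ hx => by rw [if_neg fun h => hx h.1, zero_smul]), if_pos ⟨rfl, hcd, hc⟩]
        · rw [hv c (by omega), smul_zero]
          refine Finset.sum_eq_zero fun x _ => ?_
          rw [if_neg fun h => hc h.2.2, zero_smul]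
      · rw [Finset.sum_eq_zero fun x _ => by rw [coord_of_not hdb, ite_self, zero_smul],
          Finset.sum_eq_zero fun x hx => by
            rw [pathElt_smul_smul_of_ne, smul_zero]
            rintro rfl
            exact hdb (Finset.mem_Ico.1 hx)])

theorem fromInterval_apply (v : M)
    (hv : ∀ c, c < a.val → pathElt k n c (b.val - 1) • v = 0) (w : Interval k a b) :
    fromInterval v hv w =
      ∑ x ∈ Finset.Ico a.val b.val, coord a b x w • pathElt k n x (b.val - 1) • v := by
  simp only [fromInterval, linearMapOfPaths_apply, LinearMap.coe_sum, Finset.sum_apply,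
    LinearMap.smulRight_apply]

end Universal

/-- The basis vector of `[a, b]` at a vertex. -/
noncomputable def basisVec (k : Type u) [Field k] {n : ℕ} (a b : Fin (n + 1)) (x : ℕ) :
    Interval k a b := ofCoord a b fun y => if y = x then 1 else 0

theorem coord_basisVec_self {x : ℕ} (h : a.val ≤ x) (h' : x < b.val) :
    coord a b x (basisVec k a b x) = 1 := by
  rw [basisVec, coord_ofCoord _ h h', if_pos rfl]

theorem coord_basisVec_of_ne {x y : ℕ} (h : y ≠ x) :
    coord a b y (basisVec k a b x) = 0 := by
  by_cases hy : a.val ≤ y ∧ y < b.val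
  · rw [basisVec, coord_ofCoord _ hy.1 hy.2, if_neg h]
  · exact coord_of_not hy _

/-- The generator of `[a, b]`: the basis vector at the vertex `b - 1`. -/
noncomputable def topVec (k : Type u) [Field k] {n : ℕ} (a b : Fin (n + 1)) : Interval k a b :=
  basisVec k a b (b.val - 1)

theorem pathElt_smul_topVec_of_lt {c : ℕ} (h : c < a.val) (d : ℕ) :
    pathElt k n c d • topVec k a b = 0 := by
  refine coord_ext fun x _ _ => ?_
  rw [coord_pathElt_smul, if_neg (by omega), map_zero]

theorem pathElt_smul_topVec {x : ℕ} (h : a.val ≤ x) (h' : x < b.val) :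
    pathElt k n x (b.val - 1) • topVec k a b = basisVec k a b x := by
  refine coord_ext fun y hy _ => ?_
  rw [coord_pathElt_smul]
  by_cases hyx : y = x
  · subst hyx
    rw [if_pos ⟨rfl, by omega, h⟩, topVec, coord_basisVec_self (by omega) (by omega),
      coord_basisVec_self h h']
  · rw [if_neg fun h => hyx h.1, coord_basisVec_of_ne hyx]

theorem pathElt_smul_eq_coord_smul (x : ℕ) (w : Interval k a b) :
    pathElt k n x x • w = coord a b x w • pathElt k n x (b.val - 1) • topVec k a b := by
  by_cases hx : a.val ≤ x ∧ x < b.val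
  · rw [pathElt_smul_topVec hx.1 hx.2]
    refine coord_ext fun y hy _ => ?_
    rw [coord_pathElt_smul, map_smul, smul_eq_mul]
    by_cases hyx : y = x
    · subst hyx
      rw [if_pos ⟨rfl, le_rfl, hx.1⟩, coord_basisVec_self hx.1 hx.2, mul_one]
    · rw [if_neg fun h => hyx h.1, coord_basisVec_of_ne hyx, mul_zero]
  · rw [coord_of_not hx, zero_smul]
    refine coord_ext fun y hy _ => ?_
    rw [coord_pathElt_smul, coord_of_not hx, ite_self, map_zero]

/-- `[a, b]` is generated by `topVec`. -/
theorem interval_hom_ext {M : Type*} [AddCommGroup M] [Module (Lam k n) M]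
    {f g : Interval k a b →ₗ[Lam k n] M} (h : f (topVec k a b) = g (topVec k a b)) : f = g := by
  ext w
  rw [← sum_pathElt_smul (k := k) (n := n) w, map_sum, map_sum]
  refine Finset.sum_congr rfl fun x _ => ?_
  rw [pathElt_smul_eq_coord_smul, ← algebraMap_smul (Lam k n) (coord a b x w)
    (pathElt k n x (b.val - 1) • topVec k a b), map_smul, map_smul, map_smul, map_smul, h]

theorem fromInterval_topVec {M : Type*} [AddCommGroup M] [Module (Lam k n) M] [Module k M]
    [IsScalarTower k (Lam k n) M] (hab : a < b) (v : M)
    (hv : ∀ c, c < a.val → pathElt k n c (b.val - 1) • v = 0) :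
    fromInterval v hv (topVec k a b) = pathElt k n (b.val - 1) (b.val - 1) • v := by
  have h := Fin.lt_def.1 hab
  rw [fromInterval_apply, Finset.sum_eq_single_of_mem (b.val - 1) (Finset.mem_Ico.2 (by omega)),
    topVec, coord_basisVec_self (by omega) (by omega), one_smul]
  intro x _ hx
  rw [topVec, coord_basisVec_of_ne hx, zero_smul]

end Coord

/-! ### Homomorphisms between interval modules -/

section Hom

variable {k : Type u} [Field k] {n : ℕ} {a b c d : Fin (n + 1)}

/-- A homomorphism commutes with the path from the generator's vertex `b - 1` down to `y`, so it
acts at every common vertex by the same scalar, the one seen on the generator. -/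
theorem coord_hom_apply (f : Interval k a b →ₗ[Lam k n] Interval k c d) (w : Interval k a b)
    (y : ℕ) : coord c d y (f w) =
      if c.val ≤ y then coord a b y w * coord c d (b.val - 1) (f (topVec k a b)) else 0 := by
  split_ifs with hy
  · have h1 : coord c d y (f w) = coord c d y (pathElt k n y y • f w) := by
      rw [coord_pathElt_smul, if_pos ⟨rfl, le_rfl, hy⟩]
    rw [h1, ← map_smul, pathElt_smul_eq_coord_smul,
      ← algebraMap_smul (Lam k n) (coord a b y w) (pathElt k n y (b.val - 1) • topVec k a b),
      f.map_smul, f.map_smul, algebraMap_smul, (coord c d y).map_smul, smul_eq_mul]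
    by_cases hab : a.val ≤ y ∧ y < b.val
    · rw [coord_pathElt_smul, if_pos ⟨rfl, by omega, hy⟩]
    · rw [coord_of_not hab, zero_mul, zero_mul]
  · exact coord_of_not (fun h => hy h.1) _

/-- The scalar of a nonzero map is nonzero, so `b - 1` lies in the support of `[c, d]`. If `c < a`,
the path from `b - 1` to `c` would kill the generator but not its image. -/
theorem le_of_interval_hom_ne_zero {f : Interval k a b →ₗ[Lam k n] Interval k c d} (hf : f ≠ 0) :
    a ≤ c ∧ c < b ∧ b ≤ d := by
  have hs : coord c d (b.val - 1) (f (topVec k a b)) ≠ 0 := by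
    intro hs
    refine hf (LinearMap.ext fun w => coord_ext fun y h1 h2 => ?_)
    rw [coord_hom_apply, hs, mul_zero, ite_self, LinearMap.zero_apply, map_zero]
  have hab : a < b := by
    by_contra h
    have := interval_subsingleton (k := k) (not_lt.1 h)
    exact hf (LinearMap.ext fun w => by rw [Subsingleton.elim w 0, map_zero, map_zero])
  rw [Fin.lt_def] at hab
  have hcd : c.val ≤ b.val - 1 ∧ b.val - 1 < d.val := by
    by_contra h
    exact hs (coord_of_not h _)
  rw [Fin.le_def, Fin.lt_def, Fin.le_def]
  refine ⟨?_, by omega, by omega⟩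
  by_contra h
  refine hs ?_
  have h1 := coord_pathElt_smul c.val c.val (b.val - 1) (f (topVec k a b))
  rwa [← map_smul, pathElt_smul_topVec_of_lt (by omega), map_zero, map_zero,
    if_pos ⟨rfl, by omega, le_rfl⟩, eq_comm] at h1

/-- The canonical homomorphism `[a, b] → [c, d]`, where `a ≤ c` and `b ≤ d`: restriction to the
common part of the supports. -/
noncomputable def intervalHom (k : Type u) [Field k] {n : ℕ} {a b c d : Fin (n + 1)}
    (_hac : a ≤ c) (hbd : b ≤ d) : Interval k a b →ₗ[Lam k n] Interval k c d :=
  toInterval (coord a b c.val) fun m => by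
    rw [coord_pathElt_smul, coord_of_not (fun h => by rw [Fin.le_def] at hbd; omega), ite_self]

theorem coord_intervalHom (hac : a ≤ c) (hbd : b ≤ d) (w : Interval k a b) {x : ℕ}
    (hx : c.val ≤ x) : coord c d x (intervalHom k hac hbd w) = coord a b x w := by
  rw [Fin.le_def] at hac hbd
  by_cases hxd : x < d.val
  · rw [intervalHom, coord_toInterval _ _ _ hx hxd, coord_pathElt_smul, if_pos ⟨rfl, hx, hac⟩]
  · rw [coord_of_not fun h => hxd h.2, coord_of_not fun h => by omega]

theorem intervalHom_ne_zero (hac : a ≤ c) (hcb : c < b) (hbd : b ≤ d) :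
    intervalHom k hac hbd ≠ 0 := by
  intro h
  have hcb' := Fin.lt_def.1 hcb
  have hac' := Fin.le_def.1 hac
  have h1 := coord_intervalHom hac hbd (basisVec k a b c.val) le_rfl
  rw [h, LinearMap.zero_apply, map_zero, coord_basisVec_self hac' hcb'] at h1
  exact zero_ne_one h1

/-- The isomorphism and its inverse are both nonzero homomorphisms, which gives the inequalities
between endpoints in both directions. -/
theorem eq_of_intervalEquiv (hab : a < b) (e : Interval k a b ≃ₗ[Lam k n] Interval k c d) :
    a = c ∧ b = d := by
  have hab' := Fin.lt_def.1 hab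
  have ht : topVec k a b ≠ 0 := fun h => by
    have := coord_basisVec_self (k := k) (a := a) (b := b) (x := b.val - 1) (by omega) (by omega)
    rw [← topVec, h, map_zero] at this
    exact zero_ne_one this
  have h1 : e.toLinearMap ≠ 0 := fun h => by
    refine ht (e.injective ?_)
    rw [map_zero]
    exact LinearMap.congr_fun h _
  have h2 : e.symm.toLinearMap ≠ 0 := fun h => by
    refine ht ?_
    rw [← e.symm_apply_apply (topVec k a b)]
    exact LinearMap.congr_fun h _
  obtain ⟨h3, -, h4⟩ := le_of_interval_hom_ne_zero h1
  obtain ⟨h5, -, h6⟩ := le_of_interval_hom_ne_zero h2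
  exact ⟨le_antisymm h3 h5, le_antisymm h4 h6⟩

/-- Every endomorphism is multiplication by the scalar of `coord_hom_apply`; a nonzero scalar is
inverted in `k`. -/
theorem isBrick_interval (hab : a < b) : IsBrick (intervalModule k a b) := by
  have hab' := Fin.lt_def.1 hab
  refine ⟨?_, ?_⟩
  · change Nontrivial (Module.End (Lam k n) (Interval k a b))
    exact ⟨intervalHom k le_rfl le_rfl, 0, intervalHom_ne_zero le_rfl hab le_rfl⟩
  · change ∀ f : Interval k a b →ₗ[Lam k n] Interval k a b, f ≠ 0 → _
    intro f hf
    have hs : coord a b (b.val - 1) (f (topVec k a b)) ≠ 0 := by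
      intro hs
      refine hf (LinearMap.ext fun w => coord_ext fun y h1 h2 => ?_)
      rw [coord_hom_apply, hs, mul_zero, ite_self, LinearMap.zero_apply, map_zero]
    refine (Module.End.isUnit_iff (M := Interval k a b) (R := Lam k n) f).2 ⟨?_, ?_⟩
    · refine (injective_iff_map_eq_zero f).2 fun w hw => coord_ext fun y h1 _ => ?_
      have := coord_hom_apply f w y
      rw [hw, map_zero, if_pos h1, eq_comm, mul_eq_zero, or_iff_left hs] at this
      rw [this, map_zero]
    · intro w
      refine ⟨(coord a b (b.val - 1) (f (topVec k a b)))⁻¹ • w, coord_ext fun y h1 _ => ?_⟩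
      rw [coord_hom_apply, if_pos h1, map_smul, smul_eq_mul, mul_right_comm, inv_mul_cancel₀ hs,
        one_mul]

/-! ### Short exact sequences of interval modules -/

theorem intervalHom_injective (hbd : b ≤ d) :
    Function.Injective (intervalHom k (le_refl a) hbd) := by
  refine (injective_iff_map_eq_zero _).2 fun w hw => coord_ext fun y h1 _ => ?_
  rw [← coord_intervalHom le_rfl hbd w h1, hw, map_zero, map_zero]

theorem intervalHom_surjective (hac : a ≤ c) :
    Function.Surjective (intervalHom k hac (le_refl b)) := by
  intro w
  refine ⟨ofCoord a b fun x => coord c b x w, coord_ext fun y h1 h2 => ?_⟩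
  rw [coord_intervalHom _ _ _ h1, coord_ofCoord _ ((Fin.le_def.1 hac).trans h1) h2]

theorem intervalHom_exact (hac : a ≤ c) (hcb : c ≤ b) :
    Function.Exact (intervalHom k (le_refl a) hcb) (intervalHom k hac (le_refl b)) := by
  intro w
  constructor
  · intro hw
    refine ⟨ofCoord a c fun x => coord a b x w, coord_ext fun y h1 h2 => ?_⟩
    rw [coord_intervalHom _ _ _ h1]
    by_cases hy : y < c.val
    · rw [coord_ofCoord _ h1 hy]
    · rw [coord_of_not fun h => hy h.2, ← coord_intervalHom hac le_rfl w (not_lt.1 hy), hw,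
        map_zero]
  · rintro ⟨v, rfl⟩
    refine coord_ext fun y h1 h2 => ?_
    rw [coord_intervalHom _ _ _ h1, coord_intervalHom _ _ _ ((Fin.le_def.1 hac).trans h1),
      map_zero, coord_of_not fun h => by omega]

/-- Lifting the generator suffices: with `a = 0` there is no vertex below the support, so the
condition of `fromInterval` is void. -/
theorem interval_projective (hab : a < b) (ha : a.val = 0) :
    Module.Projective (Lam k n) (Interval k a b) := by
  refine Module.Projective.of_lifting_property'' fun f hf => ?_
  obtain ⟨m, hm⟩ := hf (topVec k a b)
  have hab' := Fin.lt_def.1 hab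
  refine ⟨fromInterval m fun c hc => absurd hc (by omega), interval_hom_ext ?_⟩
  rw [LinearMap.comp_apply, fromInterval_topVec hab, map_smul, hm,
    pathElt_smul_topVec (by omega) (by omega)]
  rfl

/-! ### Extensions of interval modules -/

/-- In the long exact sequence `Ext¹(P, Y)` vanishes, so each class in `Ext¹(X, Y)` comes from a
homomorphism `K → Y`. -/
theorem subsingleton_ext_one {R : Type u} [Ring R] {K P X Y : Type u} [AddCommGroup K] [Module R K]
    [AddCommGroup P] [Module R P] [AddCommGroup X] [Module R X] [AddCommGroup Y] [Module R Y]
    [Module.Projective R P] {i : K →ₗ[R] P} {p : P →ₗ[R] X} (hi : Function.Injective i)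
    (hp : Function.Surjective p) (hip : Function.Exact i p) (h0 : ∀ f : K →ₗ[R] Y, f = 0) :
    Subsingleton (Abelian.Ext (ModuleCat.of R X) (ModuleCat.of R Y) 1) := by
  let S : ShortComplex (ModuleCat.{u} R) := ShortComplex.mk (ModuleCat.ofHom i) (ModuleCat.ofHom p)
    (by ext x; exact hip.apply_apply_eq_zero x)
  have hS : S.ShortExact := ModuleCat.shortComplex_shortExact S hip hi hp
  have : Projective S.X₂ := (IsProjective.iff_projective P).1 inferInstance
  refine subsingleton_of_forall_eq 0 fun x => ?_
  obtain ⟨x₁, rfl⟩ := Abelian.Ext.contravariant_sequence_exact₃ hS (ModuleCat.of R Y) x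
    (Abelian.Ext.eq_zero_of_projective _) (n₀ := 0) rfl
  obtain ⟨f, rfl⟩ := (Abelian.Ext.mk₀_bijective _ _).2 x₁
  have hf : f = 0 := ModuleCat.hom_ext (h0 f.hom)
  rw [hf, Abelian.Ext.mk₀_zero, Abelian.Ext.comp_zero]

/-- `Ext¹([a, b], [c, d])` vanishes if `a ≤ c`. -/
theorem subsingleton_ext_interval (hab : a < b) (hac : a ≤ c) {X Y : Type u} [AddCommGroup X]
    [Module (Lam k n) X] [AddCommGroup Y] [Module (Lam k n) Y]
    (eX : Interval k a b ≃ₗ[Lam k n] X) (eY : Interval k c d ≃ₗ[Lam k n] Y) :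
    Subsingleton (Abelian.Ext (ModuleCat.of (Lam k n) X) (ModuleCat.of (Lam k n) Y) 1) := by
  -- The projective resolution used is `0 → [0, a] → [0, b] → [a, b] → 0`; a nonzero map `[0, a] →
  -- [c, d]` would require `c < a`.
  have := interval_projective (k := k) (a := 0) (b := b) ((Fin.zero_le a).trans_lt hab) rfl
  refine subsingleton_ext_one (intervalHom_injective (k := k) (a := 0) hab.le)
    (p := eX.toLinearMap ∘ₗ intervalHom k (Fin.zero_le a) le_rfl)
    (eX.surjective.comp (intervalHom_surjective (Fin.zero_le a))) ?_ ?_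
  · intro w
    rw [LinearMap.comp_apply, LinearEquiv.coe_coe, LinearEquiv.map_eq_zero_iff]
    exact intervalHom_exact (Fin.zero_le a) hab.le w
  · intro f
    by_contra hf
    have h1 : eY.symm.toLinearMap ∘ₗ f ≠ 0 := fun h => hf (LinearMap.ext fun w =>
      eY.symm.injective (by rw [LinearMap.zero_apply, map_zero]; exact LinearMap.congr_fun h w))
    exact absurd (le_of_interval_hom_ne_zero h1).2.1 (not_lt.2 hac)

/-! ### Bricks are interval modules -/

/-- Let `t` be the top vertex of `M` and `s` the lowest vertex reached nontrivially from `t`.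
Extremality of `t` and `s` yields maps `π : M → [s, t + 1]` and `ι` in the other direction with `π ∘
ι ≠ 0`. Since the interval is a brick, this composite is bijective, so `ι ∘ π ≠ 0`, and that is a
unit since `M` is a brick too. -/
theorem exists_intervalEquiv_of_brick {M : Type u} [AddCommGroup M] [Module (Lam k n) M]
    [Nontrivial M] (hM : ∀ f : Module.End (Lam k n) M, f ≠ 0 → IsUnit f) :
    ∃ a b : Fin (n + 1), a < b ∧ Nonempty (Interval k a b ≃ₗ[Lam k n] M) := by
  classical
  let _ : Module k M := Module.compHom M (algebraMap k (Lam k n))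
  have _ : IsScalarTower k (Lam k n) M := IsScalarTower.of_algebraMap_smul fun _ _ => rfl
  have hex : ∃ x, x < n ∧ ∃ m : M, pathElt k n x x • m ≠ 0 := by
    by_contra! h
    obtain ⟨m, hm⟩ := exists_ne (0 : M)
    refine hm ?_
    rw [← sum_pathElt_smul (k := k) (n := n) m]
    exact Finset.sum_eq_zero fun x hx => h x (Finset.mem_range.1 hx) m
  obtain ⟨x₀, hx₀, hm₀⟩ := hex
  set t := Nat.findGreatest (fun x => ∃ m : M, pathElt k n x x • m ≠ 0) (n - 1) with ht
  have htop : ∃ m : M, pathElt k n t t • m ≠ 0 :=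
    Nat.findGreatest_spec (P := fun x => ∃ m : M, pathElt k n x x • m ≠ 0)
      (show x₀ ≤ n - 1 by omega) hm₀
  have htn : t < n := by
    have := Nat.findGreatest_le (P := fun x => ∃ m : M, pathElt k n x x • m ≠ 0) (n - 1)
    omega
  have hmax : ∀ x, t < x → ∀ m : M, pathElt k n x x • m = 0 := by
    intro x hx m
    by_cases hxn : n ≤ x
    · rw [pathElt_of_le k hxn, zero_smul]
    · by_contra h
      exact Nat.findGreatest_is_greatest hx (by omega) ⟨m, h⟩
  have hbot : ∃ c, ∃ m : M, pathElt k n c t • m ≠ 0 := ⟨t, htop⟩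
  set s := Nat.find hbot with hs
  obtain ⟨m, hm⟩ := Nat.find_spec hbot
  rw [← hs] at hm
  have hmin : ∀ c, c < s → ∀ m : M, pathElt k n c t • m = 0 := by
    intro c hc m
    by_contra h
    exact Nat.find_min hbot hc ⟨m, h⟩
  have hst : s ≤ t := Nat.find_min' hbot htop
  let a : Fin (n + 1) := ⟨s, by omega⟩
  let b : Fin (n + 1) := ⟨t + 1, by omega⟩
  have hab : a < b := Fin.lt_def.2 (show s < t + 1 by omega)
  -- A linear form that detects the image of `m` at `s` makes the composite `π ∘ ι` nonzero.
  obtain ⟨φ, hφ⟩ : ∃ φ : M →ₗ[k] k, φ (pathElt k n s t • m) ≠ 0 := by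
    by_contra! h
    exact hm ((Module.forall_dual_apply_eq_zero_iff k _).1 h)
  let π : M →ₗ[Lam k n] Interval k a b := toInterval φ fun m => by
    change φ (pathElt k n s (t + 1) • m) = 0
    rw [← pathElt_smul_smul (show s ≤ t + 1 by omega) le_rfl, hmax _ t.lt_succ_self, smul_zero,
      map_zero]
  let ι : Interval k a b →ₗ[Lam k n] M := fromInterval m fun c hc => hmin c hc m
  have hπι : π ∘ₗ ι ≠ 0 := by
    intro h
    have h1 := LinearMap.congr_fun h (topVec k a b)
    rw [LinearMap.comp_apply, fromInterval_topVec hab, LinearMap.zero_apply] at h1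
    have h2 := congrArg (coord a b t) h1
    rw [coord_toInterval _ _ _ hst (Nat.lt_succ_self t), map_zero] at h2
    change φ (pathElt k n s t • pathElt k n t t • m) = 0 at h2
    rw [pathElt_smul_smul hst le_rfl] at h2
    exact hφ h2
  have hbij : Function.Bijective (π ∘ₗ ι) :=
    (Module.End.isUnit_iff (M := Interval k a b) (R := Lam k n) _).1
      ((isBrick_interval hab).2 _ hπι)
  have hιπ : ι ∘ₗ π ≠ 0 := by
    intro h
    refine hπι (LinearMap.ext fun w => hbij.1 ?_)
    rw [LinearMap.zero_apply, map_zero]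
    have := LinearMap.congr_fun h (ι w)
    simp only [LinearMap.comp_apply, LinearMap.zero_apply] at this ⊢
    rw [this, map_zero]
  have hsurj := ((Module.End.isUnit_iff _).1 (hM _ hιπ)).2
  refine ⟨a, b, hab, ⟨LinearEquiv.ofBijective ι ⟨?_, ?_⟩⟩⟩
  · exact Function.Injective.of_comp (f := π) hbij.1
  · exact Function.Surjective.of_comp (g := π) hsurj

/-! ### Isomorphism classes -/

theorem cls_eq_iff {R : Type u} [Ring R] {X Y : FinMod R} :
    cls X = cls Y ↔ Nonempty (X.obj ≃ₗ[R] Y.obj) := by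
  refine Quotient.eq.trans ⟨?_, ?_⟩
  · rintro ⟨e⟩
    exact ⟨((FiniteLength R).ι.mapIso e).toLinearEquiv⟩
  · rintro ⟨e⟩
    exact ⟨ObjectProperty.isoMk _ e.toModuleIso⟩

theorem cls_intervalModule_inj (hab : a < b)
    (h : cls (intervalModule k a b) = cls (intervalModule k c d)) : a = c ∧ b = d := by
  obtain ⟨e⟩ := cls_eq_iff.1 h
  exact eq_of_intervalEquiv hab e

theorem exists_cls_eq_of_isBrick {X : FinMod (Lam k n)} (hX : IsBrick X) :
    ∃ a b : Fin (n + 1), a < b ∧ cls X = cls (intervalModule k a b) := by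
  have : Nontrivial X.obj := by
    have := hX.1
    by_contra h
    rw [not_nontrivial_iff_subsingleton] at h
    exact not_subsingleton (Module.End (Lam k n) X.obj) inferInstance
  obtain ⟨a, b, hab, ⟨e⟩⟩ := exists_intervalEquiv_of_brick hX.2
  exact ⟨a, b, hab, cls_eq_iff.2 ⟨e.symm⟩⟩

end Hom

/-! ### Extension closures -/

section ExtClosure

variable {R : Type u} [Ring R] {S T : Set (IsoClass R)}

/-- Turns the filtration into an induction over short exact sequences with last factor in `S`. `C`
need not be invariant under isomorphism, because the induction runs over all modules isomorphic to a
filtration step. -/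
theorem extClosure_induction {C : ObjectProperty (ModuleCat.{u} R)}
    (zero : ∀ (M : Type u) [AddCommGroup M] [Module R M], Subsingleton M → C (ModuleCat.of R M))
    (step : ∀ (N M : Type u) [AddCommGroup N] [Module R N] [AddCommGroup M] [Module R M]
      (X : FinMod R) (i : N →ₗ[R] M) (p : M →ₗ[R] X.obj), Function.Injective i →
      Function.Surjective p → Function.Exact i p → cls X ∈ S → C (ModuleCat.of R N) →
      C (ModuleCat.of R M)) :
    extClosure S ≤ C := by
  rintro M ⟨m, F, hF, h0, hm, hX⟩
  suffices h : ∀ i, i ≤ m → ∀ (M' : Type u) [AddCommGroup M'] [Module R M'],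
      (F i ≃ₗ[R] M') → C (ModuleCat.of R M') from
    h m le_rfl M ((LinearEquiv.ofEq _ _ hm).trans Submodule.topEquiv)
  intro i
  induction i with
  | zero =>
    intro _ M' _ _ e
    refine zero M' ?_
    have : Subsingleton (F 0) := by rw [h0]; infer_instance
    exact e.symm.toEquiv.subsingleton
  | succ i ih =>
    intro hi M' _ _ e
    obtain ⟨X, hXS, ⟨g⟩⟩ := hX i hi
    have hle : F i ≤ F (i + 1) := hF i.le_succ
    refine step (F i) M' X (e.toLinearMap ∘ₗ Submodule.inclusion hle)
      (g.toLinearMap ∘ₗ ((F i).submoduleOf (F (i + 1))).mkQ ∘ₗ e.symm.toLinearMap)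
      (e.injective.comp (Submodule.inclusion_injective hle))
      (g.surjective.comp ((Submodule.mkQ_surjective _).comp e.symm.surjective)) ?_ hXS
      (ih (by omega) (F i) (LinearEquiv.refl R _))
    intro y
    obtain ⟨x, rfl⟩ := e.surjective y
    simp only [LinearMap.comp_apply, LinearEquiv.coe_coe, LinearEquiv.symm_apply_apply,
      LinearEquiv.map_eq_zero_iff, Submodule.mkQ_apply, Submodule.Quotient.mk_eq_zero,
      Set.mem_range, EmbeddingLike.apply_eq_iff_eq]
    refine ⟨fun hx => ⟨⟨x, hx⟩, Subtype.ext rfl⟩, ?_⟩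
    rintro ⟨z, rfl⟩
    exact z.2

theorem extClosure_of_subsingleton (S : Set (IsoClass R)) (M : Type u) [AddCommGroup M]
    [Module R M] [Subsingleton M] : extClosure S (ModuleCat.of R M) :=
  ⟨0, fun _ => ⊥, fun _ _ _ => le_rfl, rfl, Subsingleton.elim _ _,
    fun _ h => absurd h (Nat.not_lt_zero _)⟩

/-- The filtration of `N` is carried into `M` by `i`, and `M` itself is added on top; the new factor
is `M / i(N)`, which is isomorphic to `X`. -/
theorem extClosure_step {N M : Type u} [AddCommGroup N] [Module R N] [AddCommGroup M] [Module R M]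
    {X : FinMod R} {i : N →ₗ[R] M} {p : M →ₗ[R] X.obj} (hi : Function.Injective i)
    (hp : Function.Surjective p) (hip : Function.Exact i p) (hX : cls X ∈ S)
    (hN : extClosure S (ModuleCat.of R N)) : extClosure S (ModuleCat.of R M) := by
  obtain ⟨m, F, hF, h0, hm, hF'⟩ := hN
  refine ⟨m + 1, fun j => if j ≤ m then (F j).map i else ⊤, ?_, ?_, ?_, ?_⟩
  · intro j j' hjj'
    change (if j ≤ m then (F j).map i else ⊤) ≤ (if j' ≤ m then (F j').map i else ⊤)
    split_ifs with h1 h2 h2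
    · exact Submodule.map_mono (hF hjj')
    · exact le_top
    · exact absurd (hjj'.trans h2) h1
    · exact le_rfl
  · simp [h0]
  · simp
  · intro j hj
    by_cases hjm : j < m
    · obtain ⟨Y, hY, ⟨g⟩⟩ := hF' j hjm
      refine ⟨Y, hY, ?_⟩
      beta_reduce
      rw [if_pos (show j + 1 ≤ m from hjm), if_pos hjm.le]
      refine ⟨(Submodule.Quotient.equiv _ _
        (Submodule.equivMapOfInjective i hi (F (j + 1))) ?_).symm.trans g⟩
      ext ⟨y, hy⟩
      simp only [Submodule.mem_map, Submodule.submoduleOf, Submodule.mem_comap,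
        Submodule.subtype_apply]
      constructor
      · rintro ⟨z, hz, hzy⟩
        exact ⟨z, hz, congrArg Subtype.val hzy⟩
      · rintro ⟨z, hz, hzy⟩
        exact ⟨⟨z, hF j.le_succ hz⟩, hz, Subtype.ext hzy⟩
    · obtain rfl : j = m := by omega
      refine ⟨X, hX, ?_⟩
      beta_reduce
      rw [if_neg (show ¬ j + 1 ≤ j by omega), if_pos le_rfl, hm, Submodule.map_top]
      refine ⟨LinearEquiv.trans (Submodule.quotEquivOfEq _ _ ?_)
        ((p ∘ₗ (⊤ : Submodule R M).subtype).quotKerEquivOfSurjective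
          (hp.comp fun y => ⟨⟨y, trivial⟩, rfl⟩))⟩
      ext y
      exact (hip y.1).symm

theorem extClosure_of_equiv {M M' : Type u} [AddCommGroup M] [Module R M] [AddCommGroup M']
    [Module R M'] (e : M ≃ₗ[R] M') (hM : extClosure S (ModuleCat.of R M)) :
    extClosure S (ModuleCat.of R M') := by
  let C : ObjectProperty (ModuleCat.{u} R) := fun M =>
    ∀ (M' : Type u) [AddCommGroup M'] [Module R M'], (M ≃ₗ[R] M') → extClosure S (ModuleCat.of R M')
  refine extClosure_induction (S := S) (C := C) ?_ ?_ _ hM M' e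
  · intro M _ _ hM M' _ _ e
    have : Subsingleton M' := e.symm.toEquiv.subsingleton
    exact extClosure_of_subsingleton S M'
  · intro N M _ _ _ _ X i p hi hp hip hX hN M' _ _ e
    change M ≃ₗ[R] M' at e
    refine extClosure_step (i := e.toLinearMap ∘ₗ i) (p := p ∘ₗ e.symm.toLinearMap)
      (e.injective.comp hi) (hp.comp e.symm.surjective) ?_ hX (hN N (LinearEquiv.refl R _))
    intro y
    obtain ⟨x, rfl⟩ := e.surjective y
    simp only [LinearMap.comp_apply, LinearEquiv.coe_coe, LinearEquiv.symm_apply_apply,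
      Set.mem_range, EmbeddingLike.apply_eq_iff_eq]
    exact hip x

/-- The extension closure is closed under extensions. -/
theorem extClosure_of_exact {N M Q : Type u} [AddCommGroup N] [Module R N] [AddCommGroup M]
    [Module R M] [AddCommGroup Q] [Module R Q] {i : N →ₗ[R] M} {p : M →ₗ[R] Q}
    (hi : Function.Injective i) (hp : Function.Surjective p) (hip : Function.Exact i p)
    (hN : extClosure S (ModuleCat.of R N)) (hQ : extClosure S (ModuleCat.of R Q)) :
    extClosure S (ModuleCat.of R M) := by
  let C : ObjectProperty (ModuleCat.{u} R) := fun Q =>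
    ∀ (M : Type u) [AddCommGroup M] [Module R M] (i : N →ₗ[R] M) (p : M →ₗ[R] Q),
      Function.Injective i → Function.Surjective p → Function.Exact i p →
      extClosure S (ModuleCat.of R M)
  refine extClosure_induction (S := S) (C := C) ?_ ?_ _ hQ M i p hi hp hip
  · intro Q _ _ hQ M _ _ i p hi hp hip
    change M →ₗ[R] Q at p
    exact extClosure_of_equiv (LinearEquiv.ofBijective i
      ⟨hi, fun y => (hip y).1 (Subsingleton.elim (α := Q) _ _)⟩) hN
  · intro Q' Q _ _ _ _ X j q hj hq hjq hX hQ' M _ _ i p hi hp hip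
    change M →ₗ[R] Q at p
    change Function.Surjective (p : M → Q) at hp
    change Function.Exact (i : N → M) (p : M → Q) at hip
    -- `M'` is the preimage of `j(Q')` in `M`: it is an extension of `Q'` by `N`, covered by the
    -- induction hypothesis, and `M / M'` is isomorphic to `X`.
    let M' : Submodule R M := LinearMap.ker (q ∘ₗ p)
    have hM' : extClosure S (ModuleCat.of R M') := by
      have hmem : ∀ y : M', p y ∈ LinearMap.range j := fun y =>
        LinearMap.mem_range.2 ((hjq (p y)).1 (LinearMap.mem_ker.1 y.2))
      let p' : M' →ₗ[R] Q' := (LinearEquiv.ofInjective j hj).symm.toLinearMap ∘ₗ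
        LinearMap.codRestrict (LinearMap.range j) (p ∘ₗ M'.subtype) hmem
      have hjp : ∀ y : M', j (p' y) = p y := fun y =>
        congrArg Subtype.val ((LinearEquiv.ofInjective j hj).apply_symm_apply ⟨p y, hmem y⟩)
      refine hQ' M' (LinearMap.codRestrict M' i fun x => ?_) p' ?_ ?_ ?_
      · rw [LinearMap.mem_ker, LinearMap.comp_apply, hip.apply_apply_eq_zero, map_zero]
      · exact fun x y hxy => hi (congrArg Subtype.val hxy)
      · intro z
        obtain ⟨y, hy⟩ := hp (j z)
        refine ⟨⟨y, ?_⟩, hj ?_⟩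
        · rw [LinearMap.mem_ker, LinearMap.comp_apply, hy, hjq.apply_apply_eq_zero]
        · rw [hjp, hy]
      · intro y
        have h1 : p' y = 0 ↔ p y = 0 := by
          rw [← hjp]
          exact ((LinearMap.map_eq_zero_iff j hj)).symm
        refine h1.trans ((hip y).trans ⟨?_, ?_⟩)
        · rintro ⟨x, hx⟩
          exact ⟨x, Subtype.ext hx⟩
        · rintro ⟨x, hx⟩
          exact ⟨x, congrArg Subtype.val hx⟩
    refine extClosure_step (i := M'.subtype) (p := q ∘ₗ p) M'.subtype_injective (hq.comp hp) ?_ hX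
      hM'
    intro _
    exact ⟨fun hy => ⟨⟨_, hy⟩, rfl⟩, fun ⟨z, hz⟩ => hz ▸ z.2⟩

theorem extClosure_of_mem {X : FinMod R} (hX : cls X ∈ S) : extClosure S X.obj :=
  extClosure_step (N := PUnit.{u + 1}) (M := X.obj) (i := 0) (p := LinearMap.id)
    (fun _ _ _ => rfl) Function.surjective_id
    (fun _ => ⟨fun h => ⟨0, h.symm⟩, fun ⟨_, h⟩ => h.symm⟩) hX
    (extClosure_of_subsingleton S PUnit.{u + 1})

theorem extClosure_le_extClosure (h : ∀ X : FinMod R, cls X ∈ S → extClosure T X.obj) :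
    extClosure S ≤ extClosure T :=
  extClosure_induction (fun M _ _ _ => extClosure_of_subsingleton T M)
    fun _ _ _ _ _ _ X _ _ hi hp hip hX hN => extClosure_of_exact hi hp hip hN (h X hX)

end ExtClosure

/-! ### Thick subcategories -/

section Thick

variable {R : Type u} [Ring R] {S T : Set (IsoClass R)}

theorem IsThick.extClosure_le {P : ObjectProperty (ModuleCat.{u} R)} (hP : IsThick P)
    (hS : ∀ X : FinMod R, cls X ∈ S → P X.obj) : extClosure S ≤ P := by
  have := hP.extensions
  have := hP.containsZero
  refine extClosure_induction (fun M _ _ hM => ?_) fun N M _ _ _ _ X i p hi hp hip hX hN => ?_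
  -- Only some zero object `Z` is known to satisfy `P`. Any other zero module `M` is reached as an
  -- extension `0 → Z → M → Z → 0`.
  · obtain ⟨Z, hZ, hPZ⟩ := P.exists_prop_of_containsZero
    have hZ' : Subsingleton Z := ModuleCat.subsingleton_of_isZero hZ
    let D : ShortComplex (ModuleCat.{u} R) :=
      ShortComplex.mk (0 : Z ⟶ ModuleCat.of R M) (0 : ModuleCat.of R M ⟶ Z) (by simp)
    exact P.prop_X₂_of_shortExact (S := D) (ModuleCat.shortComplex_shortExact D
      (fun y => ⟨fun _ => ⟨0, Subsingleton.elim (α := M) _ _⟩,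
        fun _ => Subsingleton.elim (α := Z) _ _⟩)
      (fun _ _ _ => Subsingleton.elim (α := Z) _ _)
      (fun _ => ⟨0, Subsingleton.elim (α := Z) _ _⟩)) hPZ hPZ
  · let D : ShortComplex (ModuleCat.{u} R) := ShortComplex.mk (ModuleCat.ofHom i)
      (ModuleCat.ofHom p) (by ext x; exact hip.apply_apply_eq_zero x)
    exact P.prop_X₂_of_shortExact (S := D) (ModuleCat.shortComplex_shortExact D hip hi hp) hN
      (hS X hX)

theorem thickClosure_mono_of_extClosure_le (h : extClosure S ≤ extClosure T) :
    thickClosure S ≤ thickClosure T :=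
  fun _ hM => ⟨hM.1, fun P hP hT => hM.2 P hP fun _ hX =>
    hP.extClosure_le hT _ (h _ (extClosure_of_mem hX))⟩

theorem thickClosure_of_mem {X : FinMod R} (hX : cls X ∈ S) : thickClosure S X.obj :=
  ⟨X.property, fun _ _ hS => hS X hX⟩

theorem thickClosure_le {P : ObjectProperty (ModuleCat.{u} R)} (hP : IsThick P)
    (hS : ∀ X : FinMod R, cls X ∈ S → P X.obj) : thickClosure S ≤ P :=
  fun _ hM => hM.2 P hP hS

/-- A criterion for thickness in terms of exact sequences of modules. -/
theorem isThick_of_exact {P : ObjectProperty (ModuleCat.{u} R)}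
    (zero : P (ModuleCat.of R PUnit.{u + 1}))
    (ker : ∀ (K M N : ModuleCat.{u} R) (i : K →ₗ[R] M) (f : M →ₗ[R] N), Function.Injective i →
      Function.Exact i f → P M → P N → P K)
    (coker : ∀ (M N Q : ModuleCat.{u} R) (f : M →ₗ[R] N) (q : N →ₗ[R] Q), Function.Surjective q →
      Function.Exact f q → P M → P N → P Q)
    (ext : ∀ (K M N : ModuleCat.{u} R) (i : K →ₗ[R] M) (p : M →ₗ[R] N), Function.Injective i →
      Function.Surjective p → Function.Exact i p → P K → P N → P M) :
    IsThick fun M => FiniteLength R M ∧ P M := by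
  have hfl : ∀ M : ModuleCat.{u} R, FiniteLength R M ↔ IsNoetherian R M ∧ IsArtinian R M :=
    fun M => isFiniteLength_iff_isNoetherian_isArtinian
  refine ⟨fun M hM => hM.1, ⟨⟨ModuleCat.of R PUnit.{u + 1},
    ModuleCat.isZero_of_subsingleton _, (hfl _).2 ?_, zero⟩⟩, ⟨?_⟩, ⟨?_⟩, ⟨?_⟩⟩
  · change IsNoetherian R PUnit.{u + 1} ∧ IsArtinian R PUnit.{u + 1}
    exact ⟨inferInstance, inferInstance⟩
  · rintro _ ⟨f, κ, hκ, ⟨hX, hY⟩⟩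
    have hex := ShortComplex.exact_of_f_is_kernel (.mk κ.ι f κ.condition)
      (hκ.ofIsoLimit (Limits.Fork.ext (Iso.refl _)))
    have : Mono κ.ι := Limits.Fork.IsLimit.mono hκ
    have hi := (ModuleCat.mono_iff_injective κ.ι).1 this
    obtain ⟨h1, h2⟩ := (hfl _).1 hX.1
    exact ⟨(hfl _).2 ⟨isNoetherian_of_injective κ.ι.hom hi, isArtinian_of_injective κ.ι.hom hi⟩,
      ker _ _ _ κ.ι.hom f.hom hi
        ((ShortComplex.ShortExact.moduleCat_exact_iff_function_exact _).1 hex) hX.2 hY.2⟩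
  · rintro _ ⟨f, κ, hκ, ⟨hX, hY⟩⟩
    have hex := ShortComplex.exact_of_g_is_cokernel (.mk f κ.π κ.condition)
      (hκ.ofIsoColimit (Limits.Cofork.ext (Iso.refl _)))
    have : Epi κ.π := Limits.Cofork.IsColimit.epi hκ
    have hq := (ModuleCat.epi_iff_surjective κ.π).1 this
    obtain ⟨h1, h2⟩ := (hfl _).1 hY.1
    exact ⟨(hfl _).2 ⟨isNoetherian_of_surjective κ.π.hom (LinearMap.range_eq_top.2 hq),
        isArtinian_of_surjective _ κ.π.hom hq⟩,
      coker _ _ _ f.hom κ.π.hom hq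
        ((ShortComplex.ShortExact.moduleCat_exact_iff_function_exact _).1 hex) hX.2 hY.2⟩
  · intro D hD hX hY
    have hex := (ShortComplex.ShortExact.moduleCat_exact_iff_function_exact _).1 hD.exact
    have hr : LinearMap.range D.f.hom = LinearMap.ker D.g.hom :=
      (LinearMap.exact_iff.1 hex).symm
    obtain ⟨h1, h2⟩ := (hfl _).1 hX.1
    obtain ⟨h3, h4⟩ := (hfl _).1 hY.1
    exact ⟨(hfl _).2 ⟨isNoetherian_of_range_eq_ker D.f.hom D.g.hom hr,
        isArtinian_of_range_eq_ker D.f.hom D.g.hom hr⟩,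
      ext _ _ _ D.f.hom D.g.hom hD.moduleCat_injective_f hD.moduleCat_surjective_g hex hX.2 hY.2⟩

/-- The class of modules `M` such that the multiplication with `p` is a bijection from `e M` to
`f M`, where `e` and `f` are idempotents with `p ∈ f R e`. -/
def BijectiveAt (e f p : R) : ObjectProperty (ModuleCat.{u} R) := fun M =>
  (∀ m : M, e • m = m → p • m = 0 → m = 0) ∧
    ∀ m : M, f • m = m → ∃ m' : M, e • m' = m' ∧ p • m' = m

/-- The functors `M ↦ e M` and `M ↦ f M` are exact and `p` is a natural map between them. By the
five lemma, the modules on which it is bijective are closed under kernels, cokernels and extensions;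
the chases below spell this out. -/
theorem isThick_bijectiveAt {ι : Type*} {e f p : ι → R} (he : ∀ j, e j * e j = e j)
    (hf : ∀ j, f j * f j = f j) (hfp : ∀ j, f j * p j = p j) (hpe : ∀ j, p j * e j = p j) :
    IsThick fun M => FiniteLength R M ∧ ∀ j, BijectiveAt (e j) (f j) (p j) M := by
  have he' {M : ModuleCat.{u} R} (j : ι) (m : M) : e j • e j • m = e j • m := by
    rw [smul_smul, he]
  have hf' {M : ModuleCat.{u} R} (j : ι) (m : M) : f j • f j • m = f j • m := by
    rw [smul_smul, hf]
  have hfp' {M : ModuleCat.{u} R} (j : ι) (m : M) : f j • p j • m = p j • m := by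
    rw [smul_smul, hfp]
  have hpe' {M : ModuleCat.{u} R} (j : ι) (m : M) : p j • e j • m = p j • m := by
    rw [smul_smul, hpe]
  refine isThick_of_exact (fun _ => ⟨fun _ _ _ => rfl, fun _ _ => ⟨0, rfl, rfl⟩⟩) ?_ ?_ ?_
  · intro K M N i g hi hig hM hN j
    refine ⟨fun x h1 h2 => hi ?_, fun x hx => ?_⟩
    · rw [map_zero]
      exact (hM j).1 _ (by rw [← map_smul, h1]) (by rw [← map_smul, h2, map_zero])
    · obtain ⟨m, h1, h2⟩ := (hM j).2 (i x) (by rw [← map_smul, hx])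
      have h3 : g m = 0 := (hN j).1 _ (by rw [← map_smul, h1])
        (by rw [← map_smul, h2, hig.apply_apply_eq_zero])
      obtain ⟨y, rfl⟩ := (hig m).1 h3
      exact ⟨y, hi (by rw [map_smul, h1]), hi (by rw [map_smul, h2])⟩
  · intro M N Q g q hq hgq hM hN j
    refine ⟨fun x h1 h2 => ?_, fun x hx => ?_⟩
    · obtain ⟨y, rfl⟩ := hq x
      obtain ⟨m, hm⟩ := (hgq (p j • y)).1 (by rw [map_smul, h2])
      -- Surjectivity on `M` replaces the preimage `m` of `p y` by some `p m'`; injectivity on `N`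
      -- then identifies `e y` with `g m'`, which dies in `Q`.
      obtain ⟨m', h3, h4⟩ := (hM j).2 (f j • m) (hf' j m)
      have h5 : e j • y - g m' = 0 := by
        refine (hN j).1 _ ?_ ?_
        · rw [smul_sub, he', ← map_smul, h3]
        · rw [smul_sub, hpe', ← map_smul, h4, map_smul, hm, hfp', sub_self]
      rw [← h1, ← map_smul, sub_eq_zero.1 h5, hgq.apply_apply_eq_zero]
    · obtain ⟨y, rfl⟩ := hq x
      obtain ⟨z, h1, h2⟩ := (hN j).2 (f j • y) (hf' j y)
      exact ⟨q z, by rw [← map_smul, h1], by rw [← map_smul, h2, map_smul, hx]⟩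
  · intro K M N i q hi hq hiq hK hN j
    refine ⟨fun x h1 h2 => ?_, fun x hx => ?_⟩
    · have h3 : q x = 0 := (hN j).1 _ (by rw [← map_smul, h1]) (by rw [← map_smul, h2, map_zero])
      obtain ⟨y, rfl⟩ := (hiq x).1 h3
      rw [(hK j).1 y (hi (by rw [map_smul, h1])) (hi (by rw [map_smul, h2, map_zero])), map_zero]
    · obtain ⟨z, h1, h2⟩ := (hN j).2 (q x) (by rw [← map_smul, hx])
      obtain ⟨y, rfl⟩ := hq z
      obtain ⟨t, ht⟩ := (hiq (x - p j • y)).1 (by rw [map_sub, map_smul, h2, sub_self])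
      obtain ⟨s, h3, h4⟩ := (hK j).2 t (hi (by rw [map_smul, ht, smul_sub, hx, hfp']))
      refine ⟨e j • y + i s, ?_, ?_⟩
      · rw [smul_add, he', ← map_smul, h3]
      · rw [smul_add, hpe', ← map_smul, h4, ht, add_sub_cancel]

end Thick

/-! ### Combinatorics of partitions and arcs -/

section Combinatorics

variable {m : ℕ} {P P' : Partition m}

/-- Two elements lie in the same part of a partition. -/
def SamePart (P : Partition m) (a b : Fin m) : Prop := ∃ B ∈ P.parts, a ∈ B ∧ b ∈ B

theorem samePart_iff_mem {B : Finset (Fin m)} (hB : B ∈ P.parts) {a b : Fin m} (ha : a ∈ B) :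
    SamePart P a b ↔ b ∈ B := by
  refine ⟨?_, fun hb => ⟨B, hB, ha, hb⟩⟩
  rintro ⟨B', hB', ha', hb'⟩
  rwa [P.eq_of_mem_parts hB hB' ha ha']

theorem isArc_iff {a b : Fin m} :
    IsArc P a b ↔ a < b ∧ SamePart P a b ∧ ∀ c, a < c → c < b → ¬SamePart P a c := by
  constructor
  · rintro ⟨hab, B, hB, ha, hb, hc⟩
    exact ⟨hab, ⟨B, hB, ha, hb⟩, fun c h1 h2 h => hc c h1 h2 ((samePart_iff_mem hB ha).1 h)⟩
  · rintro ⟨hab, ⟨B, hB, ha, hb⟩, hc⟩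
    exact ⟨hab, B, hB, ha, hb, fun c h1 h2 h => hc c h1 h2 ((samePart_iff_mem hB ha).2 h)⟩

/-- Two elements of a part are joined by a chain of arcs. Stated for an arbitrary relation, this
serves both for comparing partitions and for building modules by extensions. -/
theorem samePart_induction {C : Fin m → Fin m → Prop} (arc : ∀ a b, IsArc P a b → C a b)
    (trans : ∀ a c b, a < c → c < b → C a c → C c b → C a b) {a b : Fin m} (hab : a < b)
    (h : SamePart P a b) : C a b := by
  obtain ⟨B, hB, ha, hb⟩ := h
  suffices key : ∀ l (a b : Fin m), b.val - a.val ≤ l → a < b → a ∈ B → b ∈ B → C a b from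
    key _ a b le_rfl hab ha hb
  intro l
  induction l with
  | zero => intro a b hl hab; rw [Fin.lt_def] at hab; omega
  | succ l ih =>
    intro a b hl hab ha hb
    by_cases hc : ∃ c, a < c ∧ c < b ∧ c ∈ B
    · obtain ⟨c, h1, h2, h3⟩ := hc
      have h1' := Fin.lt_def.1 h1
      have h2' := Fin.lt_def.1 h2
      exact trans a c b h1 h2 (ih a c (by omega) h1 ha h3) (ih c b (by omega) h2 h3 hb)
    · push Not at hc
      exact arc a b ⟨hab, B, hB, ha, hb, hc⟩

theorem samePart_of_le (h : P ≤ P') {a b : Fin m} (hab : SamePart P a b) : SamePart P' a b := by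
  obtain ⟨B, hB, ha, hb⟩ := hab
  obtain ⟨B', hB', hle⟩ := h hB
  exact ⟨B', hB', hle ha, hle hb⟩

theorem SamePart.symm {a b : Fin m} (h : SamePart P a b) : SamePart P b a := by
  obtain ⟨B, hB, ha, hb⟩ := h
  exact ⟨B, hB, hb, ha⟩

theorem SamePart.trans {a b c : Fin m} (h : SamePart P a b) (h' : SamePart P b c) :
    SamePart P a c := by
  obtain ⟨B, hB, ha, hb⟩ := h
  exact ⟨B, hB, ha, (samePart_iff_mem hB hb).1 h'⟩

theorem le_of_isArc (h : ∀ a b, IsArc P a b → SamePart P' a b) : P ≤ P' := by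
  have hlt : ∀ a b, a < b → SamePart P a b → SamePart P' a b := fun a b hab =>
    samePart_induction h (fun _ _ _ _ _ h1 h2 => h1.trans h2) hab
  intro B hB
  obtain ⟨a, ha⟩ := P.nonempty_of_mem_parts hB
  have hmem := P'.part_mem.2 (Finset.mem_univ a)
  have hself := P'.mem_part (Finset.mem_univ a)
  refine ⟨P'.part a, hmem, fun b hb => ?_⟩
  rcases lt_trichotomy a b with hab | rfl | hab
  · exact (samePart_iff_mem hmem hself).1 (hlt a b hab ⟨B, hB, ha, hb⟩)
  · exact hself
  · exact (samePart_iff_mem hmem hself).1 (hlt b a hab ⟨B, hB, hb, ha⟩).symm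

/-- The arc joins the neighbours of `x` in `B` on its two sides. -/
theorem exists_isArc_around {B : Finset (Fin m)} (hB : B ∈ P.parts) {i x j : Fin m} (hi : i ∈ B)
    (hj : j ∈ B) (hx : x ∉ B) (hix : i < x) (hxj : x < j) :
    ∃ a b, IsArc P a b ∧ b ∈ B ∧ i ≤ a ∧ a < x ∧ x < b ∧ b ≤ j := by
  obtain ⟨a, ha⟩ := (B.filter (· < x)).exists_maximal ⟨i, by simp [hi, hix]⟩
  obtain ⟨b, hb⟩ := (B.filter (x < ·)).exists_minimal ⟨j, by simp [hj, hxj]⟩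
  have ha1 := Finset.mem_filter.1 ha.1
  have hb1 := Finset.mem_filter.1 hb.1
  refine ⟨a, b, ⟨ha1.2.trans hb1.2, B, hB, ha1.1, hb1.1, fun c h1 h2 hc => ?_⟩, hb1.1,
    ?_, ha1.2, hb1.2, ?_⟩
  · rcases lt_trichotomy c x with h | rfl | h
    · exact ha.not_gt (Finset.mem_filter.2 ⟨hc, h⟩) h1
    · exact hx hc
    · exact hb.not_lt (Finset.mem_filter.2 ⟨hc, h⟩) h2
  · exact not_lt.1 (ha.not_gt (Finset.mem_filter.2 ⟨hi, hix⟩))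
  · exact not_lt.1 (hb.not_lt (Finset.mem_filter.2 ⟨hj, hxj⟩))

/-- A crossing of parts contains a crossing of arcs: take the arc `[a, b]` of `B` around `i'`, then
the arc `[c, d]` of `B'` around `b`. As `i' ≤ c`, the latter starts to the right of `a`. -/
theorem isNonCrossing_of_isArc
    (h : ∀ a b c d, IsArc P a b → IsArc P c d → a < c → c < b → b < d → False) :
    IsNonCrossing P := by
  intro i i' j j' h1 h2 h3 B hB B' hB' hi hj hi' hj'
  by_contra hne
  obtain ⟨a, b, hab, hbB, -, ha, hb, hbj⟩ := exists_isArc_around hB hi hj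
    (fun h => hne (P.eq_of_mem_parts hB hB' h hi')) h1 h2
  obtain ⟨c, d, hcd, -, hc, hcb, hbd, -⟩ := exists_isArc_around hB' hi' hj'
    (fun h => hne (P.eq_of_mem_parts hB hB' hbB h)) hb (hbj.trans_lt h3)
  exact h a b c d hab hcd (ha.trans_le hc) hcb hbd

/-- Increasing with unique successors and predecessors, `T` decomposes the points into disjoint
chains. These are the parts, and the steps of the chains are the arcs. -/
theorem exists_partition_isArc_iff {T : Fin m → Fin m → Prop} (hlt : ∀ a b, T a b → a < b)
    (hr : ∀ a b c, T a b → T a c → b = c) (hl : ∀ a b c, T a c → T b c → a = b) :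
    ∃ P : Partition m, ∀ a b, IsArc P a b ↔ T a b := by
  classical
  let s : Setoid (Fin m) := Relation.EqvGen.setoid T
  have hs : ∀ a b, s a b → Relation.ReflTransGen T a b ∨ Relation.ReflTransGen T b a := by
    intro a b h
    have hl' : Relator.RightUnique (Function.swap T) := fun a b c h1 h2 => hl _ _ _ h1 h2
    induction h with
    | rel a b h => exact Or.inl (.single h)
    | refl a => exact Or.inl .refl
    | symm a b _ ih => exact ih.symm
    | trans a b c _ _ ih1 ih2 =>
      -- Two chains leaving `b` are comparable by uniqueness of successors, two chains ending in `b`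
      -- by uniqueness of predecessors.
      rcases ih1 with h1 | h1 <;> rcases ih2 with h2 | h2
      · exact Or.inl (h1.trans h2)
      · have := Relation.ReflTransGen.total_of_right_unique hl' (Relation.reflTransGen_swap.2 h1)
          (Relation.reflTransGen_swap.2 h2)
        exact this.symm.imp Relation.reflTransGen_swap.1 Relation.reflTransGen_swap.1
      · exact Relation.ReflTransGen.total_of_right_unique (fun a b c => hr a b c) h1 h2
      · exact Or.inr (h2.trans h1)
  have hle : ∀ a b, Relation.ReflTransGen T a b → a ≤ b := by
    intro a b h
    induction h with
    | refl => exact le_rfl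
    | tail _ h ih => exact ih.trans (hlt _ _ h).le
  have hs' : ∀ a b, a ≤ b → s a b → Relation.ReflTransGen T a b := by
    intro a b hab h
    rcases hs a b h with h | h
    · exact h
    · rw [le_antisymm hab (hle _ _ h)]
  let P : Partition m := Finpartition.ofSetoid s
  have hP : ∀ a b, SamePart P a b ↔ s a b := fun a b => by
    rw [← Finpartition.mem_part_ofSetoid_iff_rel]
    exact samePart_iff_mem (P.part_mem.2 (Finset.mem_univ a)) (P.mem_part (Finset.mem_univ a))
  refine ⟨P, fun a b => ?_⟩
  rw [isArc_iff]
  simp only [hP]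
  constructor
  · rintro ⟨hab, hsab, hc⟩
    rcases Relation.ReflTransGen.cases_head (hs' a b hab.le hsab) with h | ⟨c, hac, hcb⟩
    · exact absurd h hab.ne
    · rcases (hle _ _ hcb).lt_or_eq with h | rfl
      · exact absurd (Relation.EqvGen.rel a c hac) (hc c (hlt _ _ hac) h)
      · exact hac
  · intro h
    refine ⟨hlt _ _ h, Relation.EqvGen.rel a b h, fun c hac hcb hs'' => ?_⟩
    rcases Relation.ReflTransGen.cases_head (hs' a c hac.le hs'') with h1 | ⟨d, had, hdc⟩
    · exact hac.ne h1
    · rw [← hr a b d h had] at hdc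
      exact absurd hcb (not_lt.2 (hle _ _ hdc))

/-- Two positions `c` and `d` are not separated by `P`: for `i < j` in the same part of `P`, the
interval `[i, j)` contains both of them or none of them. -/
def Unseparated (P : Partition m) (c d : ℕ) : Prop :=
  ∀ i j : Fin m, i < j → SamePart P i j → ((i.val ≤ c ∧ c < j.val) ↔ (i.val ≤ d ∧ d < j.val))

/-- If `a < b` are in different parts of a non-crossing partition `P`, then there are positions
which are separated by `[a, b)`, but not by `P`. -/
theorem exists_unseparated (hP : IsNonCrossing P) {a b : Fin m} (hab : a < b)
    (h : ¬SamePart P a b) :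
    ∃ c d : ℕ, c < d ∧ d < m ∧ Unseparated P c d ∧
      ¬((a.val ≤ c ∧ c < b.val) ↔ (a.val ≤ d ∧ d < b.val)) := by
  -- Position `x` is viewed as the gap between `x` and `x + 1` on a circle, with `m - 1` the gap
  -- between the last and the first point. The point `b` lies strictly between two cyclically
  -- consecutive elements `p` and `q` of `B`. The gap after `p` and the gap before `q` are the
  -- positions sought: an interval with ends in one part that separates them would cross `B` or have
  -- its ends in `B`.
  obtain ⟨B, hB, ha⟩ : ∃ B ∈ P.parts, a ∈ B :=
    ⟨P.part a, P.part_mem.2 (Finset.mem_univ a), P.mem_part (Finset.mem_univ a)⟩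
  have hb : b ∉ B := fun hb => h ⟨B, hB, ha, hb⟩
  have hne : ∀ x ∈ B, x.val ≠ b.val := fun x hx hxb => hb (Fin.ext hxb ▸ hx)
  have hsame : ∀ i j, SamePart P i j → (i ∈ B ↔ j ∈ B) := fun i j hij =>
    ⟨fun hi => (samePart_iff_mem hB hi).1 hij, fun hj => (samePart_iff_mem hB hj).1 hij.symm⟩
  have hmem : ∀ i j : Fin m, SamePart P i j → ∀ x ∈ B, i.val = x.val ∨ j.val = x.val →
      i ∈ B ∧ j ∈ B := by
    intro i j hij x hx hx'
    rcases hx' with hx' | hx'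
    · have hi : i ∈ B := Fin.ext hx' ▸ hx
      exact ⟨hi, (hsame i j hij).1 hi⟩
    · have hj : j ∈ B := Fin.ext hx' ▸ hx
      exact ⟨(hsame i j hij).2 hj, hj⟩
  have hcross : ∀ i j : Fin m, SamePart P i j → ∀ x ∈ B, ∀ y ∈ B,
      (i.val < x.val ∧ x.val < j.val ∧ j.val < y.val) ∨
        (x.val < i.val ∧ i.val < y.val ∧ y.val < j.val) → i ∈ B ∧ j ∈ B := by
    rintro i j ⟨B', hB', hi, hj⟩ x hx y hy (⟨h1, h2, h3⟩ | ⟨h1, h2, h3⟩)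
    · rw [← hP i x j y h1 h2 h3 B' hB' B hB hi hj hx hy]
      exact ⟨hi, hj⟩
    · rw [hP x i y j h1 h2 h3 B hB B' hB' hx hy hi hj]
      exact ⟨hi, hj⟩
  obtain ⟨p, hp⟩ := (B.filter (· < b)).exists_maximal ⟨a, by simp [ha, hab]⟩
  obtain ⟨hpB, hpb⟩ := Finset.mem_filter.1 hp.1
  have hpmax : ∀ x ∈ B, x.val < b.val → x.val ≤ p.val := fun x hx hxb =>
    not_lt.1 (hp.not_gt (Finset.mem_filter.2 ⟨hx, hxb⟩))
  have hap := hpmax a ha hab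
  rw [Fin.lt_def] at hab hpb
  by_cases hex : ∃ j ∈ B, b < j
  · obtain ⟨j, hj, hbj⟩ := hex
    obtain ⟨q, hq⟩ := (B.filter (b < ·)).exists_minimal ⟨j, by simp [hj, hbj]⟩
    obtain ⟨hqB, hbq⟩ := Finset.mem_filter.1 hq.1
    have hqmin : ∀ x ∈ B, b.val < x.val → q.val ≤ x.val := fun x hx hxb =>
      not_lt.1 (hq.not_lt (Finset.mem_filter.2 ⟨hx, hxb⟩))
    rw [Fin.lt_def] at hbq
    have hgap : ∀ x ∈ B, p.val < x.val → x.val < q.val → False := by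
      intro x hx h1 h2
      have := hne x hx
      have := hpmax x hx
      have := hqmin x hx
      omega
    -- As `a ≤ p < b ≤ q - 1`, the interval `[a, b)` contains only the first of the two positions.
    refine ⟨p.val, q.val - 1, by omega, by omega, fun i j hij hs => ⟨fun h1 => ?_, fun h1 => ?_⟩,
      by omega⟩
    · by_contra h2
      by_cases hip : i.val = p.val
      · exact hgap j (hmem i j hs p hpB (Or.inl hip)).2 h1.2 (by omega)
      · exact hgap j (hcross i j hs p hpB q hqB (Or.inl (by omega))).2 h1.2 (by omega)
    · by_contra h2
      by_cases hjq : j.val = q.val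
      · exact hgap i (hmem i j hs q hqB (Or.inr hjq)).1 (by omega) (by omega)
      · exact hgap i (hcross i j hs p hpB q hqB (Or.inr (by omega))).1 (by omega) (by omega)
  · push Not at hex
    have hple : ∀ x ∈ B, x.val ≤ p.val := fun x hx =>
      hpmax x hx (lt_of_le_of_ne (hex x hx) (hne x hx))
    obtain ⟨q, hq⟩ := B.exists_minimal ⟨a, ha⟩
    have hqB := hq.1
    have hqle : ∀ x ∈ B, q.val ≤ x.val := fun x hx => not_lt.1 (hq.not_lt hx)
    have hqa := hqle a ha
    have hright : ∀ i j : Fin m, SamePart P i j → q.val ≤ i.val → i.val ≤ p.val →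
        p.val < j.val → False := by
      intro i j hs h1 h2 h3
      have hj : j ∈ B := by
        by_cases hiq : i.val = q.val
        · exact (hmem i j hs q hqB (Or.inl hiq)).2
        · by_cases hip : i.val = p.val
          · exact (hmem i j hs p hpB (Or.inl hip)).2
          · exact (hcross i j hs q hqB p hpB (Or.inr (by omega))).2
      have := hple j hj
      omega
    have hleft : ∀ i j : Fin m, SamePart P i j → i.val < q.val → q.val ≤ j.val →
        j.val ≤ p.val → False := by
      intro i j hs h1 h2 h3
      have hi : i ∈ B := by
        by_cases hjq : j.val = q.val
        · exact (hmem i j hs q hqB (Or.inr hjq)).1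
        · by_cases hjp : j.val = p.val
          · exact (hmem i j hs p hpB (Or.inr hjp)).1
          · exact (hcross i j hs q hqB p hpB (Or.inl (by omega))).1
      have := hqle i hi
      omega
    -- Here `B` has nothing beyond `b`, so the next element cyclically is its minimum `q`. The gap
    -- before it is `q - 1`, or `m - 1` when `q = 0`.
    by_cases hq0 : q.val = 0
    · refine ⟨p.val, m - 1, by omega, by omega, fun i j hij hs => ⟨fun h1 => ?_, fun h1 => ?_⟩,
        by omega⟩
      · exact (hright i j hs (by omega) h1.1 h1.2).elim
      · omega
    · refine ⟨q.val - 1, p.val, by omega, by omega, fun i j hij hs => ⟨fun h1 => ?_, fun h1 => ?_⟩,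
        by omega⟩
      · by_contra h2
        exact hleft i j hs (by omega) (by omega) (by omega)
      · by_contra h2
        exact hright i j hs (by omega) h1.1 h1.2

end Combinatorics

/-! ### Antichains and non-crossing partitions -/

section Main

variable {k : Type u} [Field k] {n : ℕ}

/-- In an antichain, interval modules with a nonzero homomorphism between them are equal. -/
theorem IsModAntichain.eq_of_le {S : Set (IsoClass (Lam k n))} (hS : IsModAntichain S)
    {a b c d : Fin (n + 1)} (hX : cls (intervalModule k a b) ∈ S)
    (hY : cls (intervalModule k c d) ∈ S) (hac : a ≤ c) (hcb : c < b) (hbd : b ≤ d) :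
    a = c ∧ b = d := by
  by_contra h
  exact intervalHom_ne_zero hac hcb hbd (hS.orthogonal _ _ hX hY
    (fun h' => h (cls_intervalModule_inj (hac.trans_lt hcb) h')) (intervalHom k hac hbd))

theorem isModAntichain_arcModules {P : Partition (n + 1)} (hP : IsNonCrossing P) :
    IsModAntichain (arcModules k P) := by
  refine ⟨?_, ?_⟩
  · rintro X ⟨a, b, hab, h⟩
    obtain ⟨e⟩ := cls_eq_iff.1 h
    change X.obj ≃ₗ[Lam k n] Interval k a b at e
    obtain ⟨h1, h2⟩ := isBrick_interval (k := k) hab.1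
    refine ⟨?_, fun f hf => ?_⟩
    · change Nontrivial (Module.End (Lam k n) (Interval k a b)) at h1
      exact e.conjRingEquiv.toEquiv.nontrivial
    · change ∀ f : Module.End (Lam k n) (Interval k a b), f ≠ 0 → IsUnit f at h2
      have h3 := h2 (e.conjRingEquiv f) (fun h => hf (e.conjRingEquiv.injective
        (h.trans (map_zero _).symm)))
      exact (MulEquiv.isUnit_map e.conjRingEquiv).1 h3
  · rintro X Y ⟨a, b, hab, hX⟩ ⟨c, d, hcd, hY⟩ hne f
    obtain ⟨eX⟩ := cls_eq_iff.1 hX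
    obtain ⟨eY⟩ := cls_eq_iff.1 hY
    change X.obj ≃ₗ[Lam k n] Interval k a b at eX
    change Y.obj ≃ₗ[Lam k n] Interval k c d at eY
    by_contra hf
    have h1 : eY.toLinearMap ∘ₗ f ∘ₗ eX.symm.toLinearMap ≠ 0 := by
      intro h
      refine hf (LinearMap.ext fun x => eY.injective ?_)
      have := LinearMap.congr_fun h (eX x)
      simpa using this
    obtain ⟨hac, hcb, hbd⟩ := le_of_interval_hom_ne_zero h1
    have hab' := isArc_iff.1 hab
    have hcd' := isArc_iff.1 hcd
    -- If both inequalities are strict, non-crossing puts the arcs into one part; a common endpoint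
    -- does so directly.
    have hsame : SamePart P a c ∨ SamePart P b d := by
      rcases hac.lt_or_eq with hac' | rfl
      · rcases hbd.lt_or_eq with hbd' | rfl
        · obtain ⟨-, B, hB, ha, hb, -⟩ := hab
          obtain ⟨-, B', hB', hc, hd, -⟩ := hcd
          obtain rfl := hP a c b d hac' hcb hbd' B hB B' hB' ha hb hc hd
          exact Or.inl ⟨B, hB, ha, hc⟩
        · exact Or.inl (hab'.2.1.trans hcd'.2.1.symm)
      · exact Or.inr (hab'.2.1.symm.trans hcd'.2.1)
    have hac' : SamePart P a c := by
      rcases hsame with h | h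
      · exact h
      · exact hab'.2.1.trans (h.trans hcd'.2.1.symm)
    obtain rfl : a = c := by
      by_contra h
      exact hab'.2.2 c (lt_of_le_of_ne hac h) hcb hac'
    obtain rfl : b = d := by
      by_contra h
      exact hcd'.2.2 b hab'.1 (lt_of_le_of_ne hbd h) hab'.2.1
    exact hne (hX.trans hY.symm)

theorem isNonCrossing_iff_isModAntichain (P : Partition (n + 1)) :
    IsNonCrossing P ↔ IsModAntichain (arcModules k P) := by
  refine ⟨isModAntichain_arcModules, fun h => isNonCrossing_of_isArc ?_⟩
  intro a b c d hab hcd hac hcb hbd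
  exact hac.ne (h.eq_of_le ⟨a, b, hab, rfl⟩ ⟨c, d, hcd, rfl⟩ hac.le hcb hbd.le).1

theorem lt_of_extArrow {S : Set (IsoClass (Lam k n))} {x y : S} (h : ExtArrow x y)
    {a b c d : Fin (n + 1)} (hab : a < b) (hx : x.1 = cls (intervalModule k a b))
    (hy : y.1 = cls (intervalModule k c d)) : c < a := by
  obtain ⟨X, Y, hX, hY, hext⟩ := h
  obtain ⟨eX⟩ := cls_eq_iff.1 (hX.trans hx)
  obtain ⟨eY⟩ := cls_eq_iff.1 (hY.trans hy)
  by_contra hca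
  have := subsingleton_ext_interval hab (not_lt.1 hca) eX.symm eY.symm
  exact not_subsingleton (Abelian.Ext X.obj Y.obj 1) this

theorem isExceptionalAntichain_arcModules {P : Partition (n + 1)} (hP : IsNonCrossing P) :
    IsExceptionalAntichain (arcModules k P) := by
  refine ⟨isModAntichain_arcModules hP, ?_⟩
  have key : ∀ x y : arcModules k P, Relation.TransGen ExtArrow x y →
      ∀ a b c d : Fin (n + 1), a < b → x.1 = cls (intervalModule k a b) →
        y.1 = cls (intervalModule k c d) → c < a := by
    intro x y h
    induction h with
    | single h => exact fun a b c d hab hx hy => lt_of_extArrow h hab hx hy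
    | @tail y z _ h ih =>
      intro a b c d hab hx hz
      obtain ⟨a', b', hab', hy⟩ := y.2
      exact (lt_of_extArrow h hab'.1 hy hz).trans (ih a b a' b' hab hx hy)
  intro x h
  obtain ⟨a, b, hab, hx⟩ := x.2
  exact lt_irrefl a (key x x h a b a b hab.1 hx hx)

/-- No acyclicity is assumed: orthogonality alone gives unique successors and predecessors, since
two intervals of `S` with a common endpoint have a nonzero map between them. -/
theorem exists_arcModules_eq {S : Set (IsoClass (Lam k n))} (hS : IsModAntichain S) :
    ∃ P : Partition (n + 1), IsNonCrossing P ∧ arcModules k P = S := by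
  obtain ⟨P, hP⟩ := exists_partition_isArc_iff
    (T := fun a b : Fin (n + 1) => a < b ∧ cls (intervalModule k a b) ∈ S) (fun a b h => h.1)
    (by
      rintro a b c ⟨hab, h1⟩ ⟨hac, h2⟩
      rcases le_total b c with h | h
      · exact (hS.eq_of_le h1 h2 le_rfl hab h).2
      · exact (hS.eq_of_le h2 h1 le_rfl hac h).2.symm)
    (by
      rintro a b c ⟨hac, h1⟩ ⟨hbc, h2⟩
      rcases le_total a b with h | h
      · exact (hS.eq_of_le h1 h2 h hbc le_rfl).1
      · exact (hS.eq_of_le h2 h1 h hac le_rfl).1.symm)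
  have hPS : arcModules k P = S := by
    ext x
    constructor
    · rintro ⟨a, b, hab, rfl⟩
      exact ((hP a b).1 hab).2
    · intro hx
      obtain ⟨X, rfl⟩ := Quotient.exists_rep x
      obtain ⟨a, b, hab, h⟩ := exists_cls_eq_of_isBrick (hS.isBrick X hx)
      exact ⟨a, b, (hP a b).2 ⟨hab, h ▸ hx⟩, h⟩
  refine ⟨P, (isNonCrossing_iff_isModAntichain (k := k) P).2 ?_, hPS⟩
  rwa [hPS]

/-! ### The order -/

theorem extClosure_arcModules_mono {P P' : Partition (n + 1)} (h : P ≤ P') :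
    extClosure (arcModules k P) ≤ extClosure (arcModules k P') := by
  refine extClosure_le_extClosure ?_
  rintro X ⟨a, b, hab, hX⟩
  obtain ⟨e⟩ := cls_eq_iff.1 hX
  refine extClosure_of_equiv (M := Interval k a b) e.symm ?_
  refine samePart_induction (P := P')
    (C := fun a b => extClosure (arcModules k P') (ModuleCat.of (Lam k n) (Interval k a b)))
    (fun a b hab => extClosure_of_mem (X := intervalModule k a b) ⟨a, b, hab, rfl⟩)
    (fun a c b hac hcb h1 h2 => ?_) hab.1 (samePart_of_le h (isArc_iff.1 hab).2.1)
  exact extClosure_of_exact (intervalHom_injective hcb.le) (intervalHom_surjective hac.le)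
    (intervalHom_exact hac.le hcb.le) h1 h2

/-! ### Thick subcategories defined by unseparated positions -/

theorem bijectiveAt_of_equiv {R : Type u} [Ring R] {e f p : R} {M N : ModuleCat.{u} R}
    (g : M ≃ₗ[R] N) (h : BijectiveAt e f p M) : BijectiveAt e f p N := by
  refine ⟨fun x h1 h2 => g.symm.injective ?_, fun x hx => ?_⟩
  · rw [map_zero]
    exact h.1 _ (by rw [← map_smul, h1]) (by rw [← map_smul, h2, map_zero])
  · obtain ⟨m, h1, h2⟩ := h.2 (g.symm x) (by rw [← map_smul, hx])
    exact ⟨g m, by rw [← map_smul, h1], by rw [← map_smul, h2, g.apply_symm_apply]⟩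

/-- The components at `c` and `d` have dimension 1 or 0, and the map between them is the identity if
both are nonzero. For `d ≥ n` the component at `d` is zero, and bijectivity says that the one at `c`
vanishes. -/
theorem bijectiveAt_interval_iff {a b : Fin (n + 1)} {c d : ℕ} (hcd : c ≤ d) :
    BijectiveAt (pathElt k n d d) (pathElt k n c c) (pathElt k n c d)
      (intervalModule k a b).obj ↔ ((a.val ≤ c ∧ c < b.val) ↔ (a.val ≤ d ∧ d < b.val)) := by
  have hbasis : ∀ x, a.val ≤ x → x < b.val →
      pathElt k n x x • basisVec k a b x = basisVec k a b x := by
    intro x h1 h2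
    rw [← pathElt_smul_topVec h1 h2, pathElt_smul_smul le_rfl (by omega)]
  change ((∀ m : Interval k a b, pathElt k n d d • m = m → pathElt k n c d • m = 0 → m = 0) ∧
    ∀ m : Interval k a b, pathElt k n c c • m = m →
      ∃ m' : Interval k a b, pathElt k n d d • m' = m' ∧ pathElt k n c d • m' = m) ↔ _
  constructor
  · rintro ⟨hinj, hsurj⟩
    constructor
    · intro hc
      by_contra hd
      obtain ⟨m, -, hm⟩ := hsurj _ (hbasis c hc.1 hc.2)
      have := congrArg (coord a b c) hm
      rw [coord_basisVec_self hc.1 hc.2, coord_pathElt_smul, coord_of_not hd, ite_self] at this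
      exact zero_ne_one this
    · intro hd
      by_contra hc
      have h1 := hinj _ (hbasis d hd.1 hd.2) (coord_ext fun x _ _ => by
        rw [coord_pathElt_smul, if_neg (by omega), map_zero])
      have h2 := coord_basisVec_self (k := k) hd.1 hd.2
      rw [h1, map_zero] at h2
      exact zero_ne_one h2
  · intro h
    refine ⟨fun m h1 h2 => ?_, fun m hm => ?_⟩
    · rw [← h1, pathElt_smul_eq_coord_smul]
      by_cases hd : a.val ≤ d ∧ d < b.val
      · have hc := h.2 hd
        have h3 := congrArg (coord a b c) h2
        rw [coord_pathElt_smul, if_pos ⟨rfl, hcd, hc.1⟩, map_zero] at h3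
        rw [h3, zero_smul]
      · rw [coord_of_not hd, zero_smul]
    · rw [pathElt_smul_eq_coord_smul] at hm
      by_cases hc : a.val ≤ c ∧ c < b.val
      · have hd := h.1 hc
        refine ⟨coord a b c m • basisVec k a b d, ?_, ?_⟩
        · rw [pathElt_smul_comm, hbasis d hd.1 hd.2]
        · rw [pathElt_smul_comm, ← pathElt_smul_topVec hd.1 hd.2,
            pathElt_smul_smul hcd (by omega), hm]
      · rw [coord_of_not hc, zero_smul] at hm
        exact ⟨0, smul_zero _, by rw [smul_zero, hm]⟩

/-- The modules of finite length which, for positions `c < d` not separated by `P`, have a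
bijective structure map from the vertex `d` to the vertex `c`. -/
def unseparatedModules (k : Type u) [Field k] {n : ℕ} (P : Partition (n + 1)) :
    ObjectProperty (ModuleCat.{u} (Lam k n)) := fun M =>
  FiniteLength (Lam k n) M ∧
    ∀ x : {x : ℕ × ℕ // x.1 < x.2 ∧ x.2 < n + 1 ∧ Unseparated P x.1 x.2},
      BijectiveAt (pathElt k n x.1.2 x.1.2) (pathElt k n x.1.1 x.1.1) (pathElt k n x.1.1 x.1.2) M

theorem isThick_unseparatedModules (P : Partition (n + 1)) : IsThick (unseparatedModules k P) :=
  isThick_bijectiveAt (fun _ => pathElt_mul k le_rfl le_rfl)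
    (fun _ => pathElt_mul k le_rfl le_rfl) (fun x => pathElt_mul k le_rfl x.2.1.le)
    (fun x => pathElt_mul k x.2.1.le le_rfl)

theorem unseparatedModules_of_mem {P : Partition (n + 1)} {X : FinMod (Lam k n)}
    (hX : cls X ∈ arcModules k P) : unseparatedModules k P X.obj := by
  obtain ⟨a, b, hab, h⟩ := hX
  obtain ⟨e⟩ := cls_eq_iff.1 h
  refine ⟨X.property, fun x => bijectiveAt_of_equiv e.symm ?_⟩
  exact (bijectiveAt_interval_iff x.2.1.le).2 (x.2.2.2 a b hab.1 (isArc_iff.1 hab).2.1)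

theorem samePart_of_unseparatedModules {P : Partition (n + 1)} (hP : IsNonCrossing P)
    {a b : Fin (n + 1)} (hab : a < b) (h : unseparatedModules k P (intervalModule k a b).obj) :
    SamePart P a b := by
  by_contra hs
  obtain ⟨c, d, hcd, hd, hun, hsep⟩ := exists_unseparated hP hab hs
  exact hsep ((bijectiveAt_interval_iff hcd.le).1 (h.2 ⟨(c, d), hcd, hd, hun⟩))

/-- The thick subcategory `unseparatedModules k P'` contains the thick closure of `A(P')`, hence
every arc module of `P`; its intervals have both endpoints in one part of `P'`. -/
theorem le_of_thickClosure_le {P P' : Partition (n + 1)} (hP' : IsNonCrossing P')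
    (h : thickClosure (arcModules k P) ≤ thickClosure (arcModules k P')) : P ≤ P' :=
  le_of_isArc fun a b hab => samePart_of_unseparatedModules (k := k) hP' hab.1
    (thickClosure_le (isThick_unseparatedModules P') (fun _ => unseparatedModules_of_mem) _
      (h _ (thickClosure_of_mem ⟨a, b, hab, rfl⟩)))

theorem extClosure_arcModules_le_iff {P P' : Partition (n + 1)} (hP' : IsNonCrossing P') :
    extClosure (arcModules k P) ≤ extClosure (arcModules k P') ↔ P ≤ P' :=
  ⟨fun h => le_of_thickClosure_le hP' (thickClosure_mono_of_extClosure_le h),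
    extClosure_arcModules_mono⟩

end Main

end ArcCat

theorem theorem4p2 (k : Type u) [Field k] (n : ℕ) :
    (∀ P : ArcCat.Partition (n + 1),
      ArcCat.IsNonCrossing P ↔ ArcCat.IsModAntichain (ArcCat.arcModules k P)) ∧
    (∃ A : ArcCat.NC (n + 1) ≃o ArcCat.ExcAntichain (ArcCat.Lam k n),
      ∀ P : ArcCat.NC (n + 1), (A P).1 = ArcCat.arcModules k P.1) ∧
    (∀ S T : ArcCat.ExcAntichain (ArcCat.Lam k n),
      S ≤ T ↔ ArcCat.thickClosure S.1 ≤ ArcCat.thickClosure T.1) := by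
  refine ⟨ArcCat.isNonCrossing_iff_isModAntichain, ?_, ?_⟩
  · let A : ArcCat.NC (n + 1) → ArcCat.ExcAntichain (ArcCat.Lam k n) := fun P =>
      ⟨ArcCat.arcModules k P.1, ArcCat.isExceptionalAntichain_arcModules P.2⟩
    have hle : ∀ P P', A P ≤ A P' ↔ P ≤ P' := fun P P' =>
      ArcCat.extClosure_arcModules_le_iff P'.2
    have hA : Function.Bijective A := by
      -- Injectivity follows from order reflection and the antisymmetry of the order on partitions.
      refine ⟨fun P P' h => le_antisymm ((hle P P').1 (h ▸ le_rfl)) ((hle P' P).1 (h ▸ le_rfl)),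
        fun S => ?_⟩
      obtain ⟨P, hP, hPS⟩ := ArcCat.exists_arcModules_eq S.2.toIsModAntichain
      exact ⟨⟨P, hP⟩, Subtype.ext hPS⟩
    exact ⟨⟨Equiv.ofBijective A hA, fun {P P'} => hle P P'⟩, fun _ => rfl⟩
  · rintro ⟨S, hS⟩ ⟨T, hT⟩
    obtain ⟨P, hP, rfl⟩ := ArcCat.exists_arcModules_eq hS.toIsModAntichain
    obtain ⟨P', hP', rfl⟩ := ArcCat.exists_arcModules_eq hT.toIsModAntichain
    exact ⟨ArcCat.thickClosure_mono_of_extClosure_le, fun h =>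
      ArcCat.extClosure_arcModules_mono (ArcCat.le_of_thickClosure_le hP' h)⟩
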